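/- **Setting.** Fix budgets $0<X_A\le X_B$ and constants $\underline w,\bar w>0$. A Generalized Lottery Blotto game $\mathcal{GLB}_n^{X_A,X_B}(\zeta)$ consists of $n\ge 3$ battlefields, battlefield values $w^A_i,w^B_i>0$ ($i\in[n]$), a tie-breaking parameter $\alpha\in[0,1]$, and a pair of contest success functions $\zeta=(\zeta_A,\zeta_B)$, i.e. functions $\mathbb R_{\ge0}^2\to\mathbb R$ with $\zeta_A,\zeta_B\ge 0$, $\zeta_A+\zeta_B=1$, $\zeta_A(x,y)$ non-decreasing in $x$ and non-increasing in $y$, and $\zeta_B(x,y)$ non-decreasing in $y$ and non-increasing in $x$. A pure strategy of player $P\in\{A,B\}$ is $\boldsymbol x\in\mathbb R^n_{\ge0}$ with $\sum_i x_i\le X_P$. The payoff of $P$ is $\Pi_P^\zeta(\boldsymbol x^A,\boldsymbol x^B)=\sum_i w^P_i\,\zeta_P(x^A_i,x^B_i)$, extended to independent mixed strategies by expectation. Let $W_P=\sum_i w^P_i$ and $v^P_i=w^P_i/W_P$. The game satisfies (A0) if $\underline w\le w^P_i\le\bar w$ for all $i$ and $P$. The Blotto functions are $\beta_A(x,y)=1,\alpha,0$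 for $x>y$, $x=y$, $x<y$ respectively, and $\beta_B=1-\beta_A$. For $\gamma>0$ let $\Omega(\gamma)=\{i: v^A_i/v^B_i>\gamma\}$, and let $\mathcal S$ be the set of $\gamma>0$ with $$\frac{X_B\gamma}{X_A}=\frac{\gamma^2\sum_{i\in\Omega(\gamma)}\frac{(v^B_i)^2}{v^A_i}+\sum_{i\notin\Omega(\gamma)}v^A_i}{\sum_{i\in\Omega(\gamma)}v^B_i+\frac1{\gamma^2}\sum_{i\notin\Omega(\gamma)}\frac{(v^A_i)^2}{v^B_i}} .$$ For $\gamma^*\in\mathcal S$ put $$\lambda_A=\tfrac{(\gamma^*)^2}{2X_B}\sum_{i\in\Omega(\gamma^*)}\tfrac{(v_i^B)^2}{v_i^A}+\tfrac1{2X_B}\sum_{i\notin\Omega(\gamma^*)}v_i^A,\qquad \lambda_B=\tfrac1{2X_A}\sum_{i\in\Omega(\gamma^*)}v_i^B+\tfrac1{2(\gamma^*)^2X_A}\sum_{i\notin\Omega(\gamma^*)}\tfrac{(v_i^A)^2}{v_i^B},$$ $a_i=v^A_i/\lambda_A$ and $b_i=v^B_i/\lambda_B$. The uniform-type distributions $F_{A^*_i},F_{B^*_i}$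 are defined as follows. If $i\in\Omega(\gamma^*)$, then on $[0,b_i]$ we have $F_{A_i^*}(x)=x/b_i$ and $F_{B_i^*}(x)=(a_i-b_i)/a_i+x/a_i$. If $i\notin\Omega(\gamma^*)$, then on $[0,a_i]$ we have $F_{A_i^*}(x)=(b_i-a_i)/b_i+x/b_i$ and $F_{B_i^*}(x)=x/a_i$. The mixed strategy $\mathrm{IU}^{\gamma^*}_A$ draws $a'_i\sim F_{A^*_i}$ independently over $i$ and allocates $x^A_i=X_A\,a'_i/\sum_j a'_j$ (and $x^A=0$ if $\sum_j a'_j=0$). $\mathrm{IU}^{\gamma^*}_B$ is defined in the same way from $F_{B^*_i}$ and $X_B$. For $\varepsilon>0$ let $\Delta_{\gamma^*}(\zeta,\varepsilon)$ be the set of $\delta\in[0,1]$ such that, for all $i\in[n]$ and all $x^*,y^*\in[0,2X_B]$, $$\int_{\{x\in[0,2X_B]:\,|\zeta_A(x,y^*)-\beta_A(x,y^*)|\ge\varepsilon\}}dF_{A^*_i}(x)\le\delta,\qquad \int_{\{y\in[0,2X_B]:\,|\zeta_B(x^*,y)-\beta_B(x^*,y)|\ge\varepsilon\}}dF_{B^*_i}(y)\le\delta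 .$$ **Theorem.** Consider the inequalities, for all pure strategies $\boldsymbol x^A,\boldsymbol x^B$, $$\Pi^\zeta_A(\boldsymbol x^A,\mathrm{IU}^{\gamma^*}_B)\le\Pi^\zeta_A(\mathrm{IU}^{\gamma^*}_A,\mathrm{IU}^{\gamma^*}_B)+(8\delta+13\varepsilon)W_A,\qquad \Pi^\zeta_B(\mathrm{IU}^{\gamma^*}_A,\boldsymbol x^B)\le\Pi^\zeta_B(\mathrm{IU}^{\gamma^*}_A,\mathrm{IU}^{\gamma^*}_B)+(8\delta+13\varepsilon)W_B.\tag{$*$}$$ (i) There is a function $f(n)=\tilde{\mathcal O}(n^{-1/2})$ (that is, $f(n)=\mathcal O(n^{-1/2}(\ln n)^k)$ for some $k\in\mathbb N$), depending only on $X_A,X_B,\underline w,\bar w$, such that for every game $\mathcal{GLB}_n^{X_A,X_B}(\zeta)$ satisfying (A0) there is $\varepsilon$ with $0<\varepsilon\le f(n)$ for which $(*)$ holds for all $\gamma^*\in\mathcal S$ and all $\delta\in\Delta_{\gamma^*}(\zeta,\varepsilon)$. (ii) There is a constant $L^*>0$, depending only on $X_A,X_B,\underline w,\bar w$, such that for every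 $\varepsilon\in(0,1]$ and every game $\mathcal{GLB}_n^{X_A,X_B}(\zeta)$ satisfying (A0) with $n\ge L^*\varepsilon^{-2}\max\{1,\ln(\varepsilon^{-1})\}$, $(*)$ holds for all $\gamma^*\in\mathcal S$ and all $\delta\in\Delta_{\gamma^*}(\zeta,\varepsilon)$. -/

import Mathlib

open MeasureTheory Set

namespace LotteryBlotto

noncomputable section

/-- `f = Õ(g)`: `f` is big-O of `g` up to a power of the logarithm of the argument. -/
def IsSoftO (f g : ℕ → ℝ) : Prop :=
  ∃ k : ℕ, f =O[Filter.atTop] fun n : ℕ => g n * Real.log n ^ k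

/-- A pair of contest success functions; only their values on `[0, ∞)²` matter.
No continuity or joint measurability is required. -/
structure CSFPair where
  A : ℝ → ℝ → ℝ
  B : ℝ → ℝ → ℝ
  nonneg_A : ∀ x y : ℝ, 0 ≤ x → 0 ≤ y → 0 ≤ A x y
  nonneg_B : ∀ x y : ℝ, 0 ≤ x → 0 ≤ y → 0 ≤ B x y
  add_eq_one : ∀ x y : ℝ, 0 ≤ x → 0 ≤ y → A x y + B x y = 1
  A_mono_left : ∀ y : ℝ, 0 ≤ y → MonotoneOn (fun x => A x y) (Ici 0)
  A_anti_right : ∀ x : ℝ, 0 ≤ x → AntitoneOn (fun y => A x y) (Ici 0)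
  B_mono_right : ∀ x : ℝ, 0 ≤ x → MonotoneOn (fun y => B x y) (Ici 0)
  B_anti_left : ∀ y : ℝ, 0 ≤ y → AntitoneOn (fun x => B x y) (Ici 0)

/-- The Blotto function of player A, with tie-breaking parameter `α`. -/
def betaA (α x y : ℝ) : ℝ := if y < x then 1 else if x = y then α else 0

/-- The Blotto function of player B, with tie-breaking parameter `α`. -/
def betaB (α x y : ℝ) : ℝ := if x < y then 1 else if y = x then 1 - α else 0

/-- The data of a Blotto game with `n` battlefields and budgets `XA`, `XB`: the players' battlefield
values and the tie-breaking parameter.  Together with a `CSFPair` this is a Generalized Lottery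
Blotto game (`α` then enters only through the comparison with the Blotto functions). -/
structure Game (n : ℕ) (XA XB : ℝ) where
  wA : Fin n → ℝ
  wB : Fin n → ℝ
  α : ℝ
  wA_pos : ∀ i, 0 < wA i
  wB_pos : ∀ i, 0 < wB i
  α_mem : α ∈ Icc (0 : ℝ) 1

/-- Pure strategies with budget `X`. -/
def PureStrategies (n : ℕ) (X : ℝ) : Set (Fin n → ℝ) :=
  {x | (∀ i, 0 ≤ x i) ∧ ∑ i, x i ≤ X}

/-- For `0 < b`, `0 ≤ c ≤ b`: the law on `[0, c]` with mass `(b - c) / b` at `0` and density `1 / b`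
on `(0, c]`, i.e. with distribution function `x ↦ (b - c) / b + x / b` on `[0, c]`
(the uniform law on `[0, b]` if `c = b`). -/
def uniformType (c b : ℝ) : Measure ℝ :=
  ENNReal.ofReal ((b - c) / b) • Measure.dirac 0 +
    ENNReal.ofReal (1 / b) • (volume : Measure ℝ).restrict (Ioc 0 c)

theorem uniformType_cdf {c b x : ℝ} (hb : 0 < b) (hcb : c ≤ b) (hx : x ∈ Icc 0 c) :
    uniformType c b (Iic x) = ENNReal.ofReal ((b - c) / b + x / b) := by
  have h1 : Iic x ∩ Ioc 0 c = Ioc 0 x := by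
    ext t
    simp only [mem_inter_iff, mem_Iic, mem_Ioc]
    constructor
    · rintro ⟨h, h', -⟩; exact ⟨h', h⟩
    · rintro ⟨h, h'⟩; exact ⟨h', h, h'.trans hx.2⟩
  have h2 : (0 : ℝ) ∈ Iic x := hx.1
  rw [uniformType, Measure.add_apply, Measure.smul_apply, Measure.smul_apply,
    Measure.restrict_apply measurableSet_Iic, h1, Real.volume_Ioc,
    Measure.dirac_apply_of_mem h2, smul_eq_mul, smul_eq_mul, mul_one,
    ← ENNReal.ofReal_mul (by positivity), ← ENNReal.ofReal_add]
  · congr 1; ring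
  · exact div_nonneg (sub_nonneg.2 hcb) hb.le
  · have := hx.1
    rw [sub_zero]; positivity

theorem uniformType_isProbabilityMeasure {c b : ℝ} (hb : 0 < b) (hc : 0 ≤ c) (hcb : c ≤ b) :
    IsProbabilityMeasure (uniformType c b) := by
  constructor
  rw [uniformType, Measure.add_apply, Measure.smul_apply, Measure.smul_apply,
    Measure.restrict_apply_univ, Real.volume_Ioc, measure_univ, smul_eq_mul, smul_eq_mul, mul_one,
    ← ENNReal.ofReal_mul (by positivity), ← ENNReal.ofReal_add]
  · rw [← ENNReal.ofReal_one]; congr 1; field_simp; ring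
  · exact div_nonneg (sub_nonneg.2 hcb) hb.le
  · rw [sub_zero]; positivity

/-- Rescale a vector so that it spends the budget `X`; if the coordinates sum to `0`, allocate `0`
to every battlefield. -/
def rescale {n : ℕ} (X : ℝ) (a : Fin n → ℝ) : Fin n → ℝ :=
  if ∑ j, a j = 0 then 0 else fun i => a i / (∑ j, a j) * X

theorem measurable_rescale {n : ℕ} (X : ℝ) : Measurable (rescale (n := n) X) := by
  have hs : Measurable fun a : Fin n → ℝ => ∑ j, a j :=
    Finset.measurable_sum _ fun j _ => measurable_pi_apply j
  refine Measurable.ite (hs (measurableSet_singleton 0)) measurable_const ?_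
  exact measurable_pi_lambda _ fun i => ((measurable_pi_apply i).div hs).mul_const X

namespace Game

variable {n : ℕ} {XA XB : ℝ} (G : Game n XA XB)

/-- Total values `W_A`, `W_B`. -/
def WA : ℝ := ∑ i, G.wA i

def WB : ℝ := ∑ i, G.wB i

/-- Normalized battlefield values. -/
def vA (i : Fin n) : ℝ := G.wA i / G.WA

def vB (i : Fin n) : ℝ := G.wB i / G.WB

/-- Battlefield values lie between `wlo` and `whi`. -/
def BoundedValues (wlo whi : ℝ) : Prop :=
  ∀ i, (wlo ≤ G.wA i ∧ G.wA i ≤ whi) ∧ (wlo ≤ G.wB i ∧ G.wB i ≤ whi)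

open Classical in
/-- `Ω_A(γ)`. -/
def Omega (γ : ℝ) : Finset (Fin n) := Finset.univ.filter fun i => γ < G.vA i / G.vB i

/-- The positive solutions `γ` of the equation
`X_B γ / X_A = (γ² ∑_{Ω} (v^B)²/v^A + ∑_{Ωᶜ} v^A) / (∑_{Ω} v^B + γ⁻² ∑_{Ωᶜ} (v^A)²/v^B)`. -/
def Solutions : Set ℝ :=
  {γ | 0 < γ ∧
    XB * γ / XA =
      (γ ^ 2 * ∑ i ∈ G.Omega γ, G.vB i ^ 2 / G.vA i + ∑ i ∈ (G.Omega γ)ᶜ, G.vA i) /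
      (∑ i ∈ G.Omega γ, G.vB i + 1 / γ ^ 2 * ∑ i ∈ (G.Omega γ)ᶜ, G.vA i ^ 2 / G.vB i)}

/-- The constant `λ_A` attached to `γ`. -/
def lamA (γ : ℝ) : ℝ :=
  γ ^ 2 / (2 * XB) * ∑ i ∈ G.Omega γ, G.vB i ^ 2 / G.vA i +
    1 / (2 * XB) * ∑ i ∈ (G.Omega γ)ᶜ, G.vA i

/-- The constant `λ_B` attached to `γ`. -/
def lamB (γ : ℝ) : ℝ :=
  1 / (2 * XA) * ∑ i ∈ G.Omega γ, G.vB i +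
    1 / (2 * γ ^ 2 * XA) * ∑ i ∈ (G.Omega γ)ᶜ, G.vA i ^ 2 / G.vB i

open Classical in
/-- The uniform-type law of player A on battlefield `i`. -/
def lawA (γ : ℝ) (i : Fin n) : Measure ℝ :=
  if i ∈ G.Omega γ then uniformType (G.vB i / G.lamB γ) (G.vB i / G.lamB γ)
  else uniformType (G.vA i / G.lamA γ) (G.vB i / G.lamB γ)

open Classical in
/-- The uniform-type law of player B on battlefield `i`. -/
def lawB (γ : ℝ) (i : Fin n) : Measure ℝ :=
  if i ∈ G.Omega γ then uniformType (G.vB i / G.lamB γ) (G.vA i / G.lamA γ)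
  else uniformType (G.vA i / G.lamA γ) (G.vA i / G.lamA γ)

/-- The independently uniform strategy of player A: the law of the allocation obtained by drawing
independently from the uniform-type laws and rescaling to the budget. -/
def IUA (γ : ℝ) : Measure (Fin n → ℝ) :=
  (Measure.pi fun i => G.lawA γ i).map (rescale XA)

/-- The independently uniform strategy of player B. -/
def IUB (γ : ℝ) : Measure (Fin n → ℝ) :=
  (Measure.pi fun i => G.lawB γ i).map (rescale XB)

/-- Payoff of player A at a pure strategy profile. -/
def purePayoffA (ζ : CSFPair) (x y : Fin n → ℝ) : ℝ := ∑ i, G.wA i * ζ.A (x i) (y i)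

/-- Payoff of player B at a pure strategy profile. -/
def purePayoffB (ζ : CSFPair) (x y : Fin n → ℝ) : ℝ := ∑ i, G.wB i * ζ.B (x i) (y i)

/-- Expected payoff of player A when A and B draw independently from the mixed strategies `s`, `t`
(a pure strategy `x` is the mixed strategy `Measure.dirac x`).  As contest success functions are
monotone in each variable, both integrands are bounded and almost everywhere measurable, also for
contest success functions that are not jointly measurable. -/
def payoffA (ζ : CSFPair) (s t : Measure (Fin n → ℝ)) : ℝ :=
  ∫ y, ∫ x, G.purePayoffA ζ x y ∂s ∂t

/-- Expected payoff of player B. -/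
def payoffB (ζ : CSFPair) (s t : Measure (Fin n → ℝ)) : ℝ :=
  ∫ y, ∫ x, G.purePayoffB ζ x y ∂s ∂t

/-- The `x ∈ [0, 2 X_B]` at which `ζ_A(·, y)` is at least `ε` away from the Blotto function. -/
def farA (ζ : CSFPair) (y ε : ℝ) : Set ℝ :=
  {x | x ∈ Icc 0 (2 * XB) ∧ ε ≤ |ζ.A x y - betaA G.α x y|}

/-- The `y ∈ [0, 2 X_B]` at which `ζ_B(x, ·)` is at least `ε` away from the Blotto function. -/
def farB (ζ : CSFPair) (x ε : ℝ) : Set ℝ :=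
  {y | y ∈ Icc 0 (2 * XB) ∧ ε ≤ |ζ.B x y - betaB G.α x y|}

/-- `Δ_γ(ζ, ε)`: the `δ ∈ [0, 1]` that bound the mass which the uniform-type laws give to the sets
where `ζ` is `ε`-far from the Blotto functions, uniformly in the battlefield and in the opponent's
allocation in `[0, 2 X_B]`. -/
def Delta (γ : ℝ) (ζ : CSFPair) (ε : ℝ) : Set ℝ :=
  {δ | δ ∈ Icc (0 : ℝ) 1 ∧
    (∀ i, ∀ y ∈ Icc 0 (2 * XB), (G.lawA γ i).real (G.farA ζ y ε) ≤ δ) ∧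
    (∀ i, ∀ x ∈ Icc 0 (2 * XB), (G.lawB γ i).real (G.farB ζ x ε) ≤ δ)}

/-- A unilateral pure deviation from the profile `(s, t)` gains player A at most `η * W_A` and
player B at most `η * W_B`. -/
def DeviationGainLe (ζ : CSFPair) (s t : Measure (Fin n → ℝ)) (η : ℝ) : Prop :=
  (∀ x ∈ PureStrategies n XA,
    G.payoffA ζ (Measure.dirac x) t ≤ G.payoffA ζ s t + η * G.WA) ∧
  (∀ y ∈ PureStrategies n XB,
    G.payoffB ζ s (Measure.dirac y) ≤ G.payoffB ζ s t + η * G.WB)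

end Game

end

end LotteryBlotto

namespace LotteryBlotto

/-! Put c_i = min(a_i, b_i). The equation for γ says γ = λ_A / λ_B, so Ω(γ) is the set where b_i <
a_i. On battlefield i both uniform-type laws live on [0, c_i], with density 1/b_i for A and 1/a_i
for B and the remaining mass at 0, and their means add up to X_A and X_B. Under Blotto payoffs an
allocation x_i beats B's law with probability at most (a_i - c_i)/a_i + x_i/a_i. Since w^A_i / a_i =
λ_A W_A does not depend on i, the resulting bound on A's payoff depends on x only through its total,
and drawing from A's own laws, whose expected total is the budget, attains the bound. The same holds
for B. So the unscaled laws form an equilibrium when budgets bind only in expectation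
(`sum_mul_le_of_indifferent`).

Two perturbations lead to the theorem. Replacing the Blotto function by ζ under a uniform-type law
costs ε + δ, by definition of Δ. Rescaling to the exact budget costs ε per marginal: comparable
values force c_i = O(1/n) (`supp_le`), so by Hoeffding the drawn total is within a factor 1 ± ε/2 of
the budget except with probability ε/2, and a scaling of the argument by such a factor changes the
integral of a monotone function by at most ε/2, because the laws have constant density and an atom
at 0 that scaling fixes (`monotoneClose_map_rescale`). Monotone test functions suffice because ζ is
monotone in each variable. The deviation is charged 2ε + δ and the equilibrium payoff 3ε + δ, well
within 13ε + 8δ. -/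

/-! ### Integrals against uniform-type laws, and scaling of the argument -/

theorem integrable_of_mem_unit {α : Type*} [MeasurableSpace α] {μ : Measure α}
    [IsFiniteMeasure μ] {g : α → ℝ} (hm : Measurable g) (hg : ∀ t, g t ∈ Icc (0 : ℝ) 1) :
    Integrable g μ :=
  Integrable.of_mem_Icc 0 1 hm.aemeasurable (ae_of_all _ hg)

theorem integral_mem_unit {α : Type*} [MeasurableSpace α] {μ : Measure α}
    [IsProbabilityMeasure μ] {g : α → ℝ} (hg : ∀ t, g t ∈ Icc (0 : ℝ) 1) :
    ∫ t, g t ∂μ ∈ Icc (0 : ℝ) 1 := by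
  refine ⟨integral_nonneg fun t => (hg t).1, ?_⟩
  calc ∫ t, g t ∂μ ≤ ∫ _, (1 : ℝ) ∂μ :=
        integral_mono_of_nonneg (ae_of_all _ fun t => (hg t).1) (integrable_const _)
          (ae_of_all _ fun t => (hg t).2)
    _ = 1 := by simp

theorem integral_uniformType {c b : ℝ} (hb : 0 < b) (hcb : c ≤ b) {g : ℝ → ℝ}
    (hg : Integrable g ((volume : Measure ℝ).restrict (Ioc 0 c))) :
    ∫ t, g t ∂uniformType c b = (b - c) / b * g 0 + 1 / b * ∫ t in Ioc 0 c, g t := by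
  rw [uniformType, integral_add_measure, integral_smul_measure, integral_smul_measure,
    integral_dirac, ENNReal.toReal_ofReal (div_nonneg (sub_nonneg.2 hcb) hb.le),
    ENNReal.toReal_ofReal (by positivity), smul_eq_mul, smul_eq_mul]
  · exact (integrable_dirac (by simp)).smul_measure ENNReal.ofReal_ne_top
  · exact hg.smul_measure ENNReal.ofReal_ne_top

theorem ae_mem_Icc_uniformType {c b : ℝ} (hc : 0 ≤ c) :
    ∀ᵐ t ∂uniformType c b, t ∈ Icc 0 c := by
  rw [uniformType, ae_add_measure_iff]
  constructor
  · refine Measure.ae_smul_measure ?_ _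
    rw [ae_dirac_eq]
    exact ⟨le_rfl, hc⟩
  · refine Measure.ae_smul_measure ?_ _
    filter_upwards [ae_restrict_mem measurableSet_Ioc] with t ht using Ioc_subset_Icc_self ht

theorem integral_id_uniformType {c b : ℝ} (hb : 0 < b) (hc : 0 ≤ c) (hcb : c ≤ b) :
    ∫ t, t ∂uniformType c b = c ^ 2 / (2 * b) := by
  rw [integral_uniformType hb hcb, ← intervalIntegral.integral_of_le hc, integral_id]
  · field_simp; ring
  · exact (continuous_id.integrableOn_Icc).mono_set Ioc_subset_Icc_self

/-- Contracting the argument of a nonnegative function costs at most the contraction factor. -/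
theorem integral_comp_mul_uniformType_le {c b r : ℝ} (hb : 0 < b) (hc : 0 ≤ c) (hcb : c ≤ b)
    (hr : 0 < r) (hr1 : r ≤ 1) {g : ℝ → ℝ} (hm : Measurable g) (hg : ∀ t, g t ∈ Icc (0 : ℝ) 1) :
    ∫ t, g (r * t) ∂uniformType c b ≤ r⁻¹ * ∫ t, g t ∂uniformType c b := by
  have hm' : Measurable fun t => g (r * t) := hm.comp (measurable_const_mul r)
  have hr' : 1 ≤ r⁻¹ := (one_le_inv₀ hr).2 hr1
  rw [integral_uniformType hb hcb (integrable_of_mem_unit hm' fun t => hg _),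
    integral_uniformType hb hcb (integrable_of_mem_unit hm hg),
    ← intervalIntegral.integral_of_le hc, intervalIntegral.integral_comp_mul_left g hr.ne',
    mul_zero, smul_eq_mul, intervalIntegral.integral_of_le (by positivity)]
  have h1 : ∫ t in Ioc 0 (r * c), g t ≤ ∫ t in Ioc 0 c, g t := by
    refine setIntegral_mono_set (integrable_of_mem_unit hm hg) (ae_of_all _ fun t => (hg t).1)
      (Ioc_subset_Ioc_right ?_).eventuallyLE
    nlinarith
  have h2 : 0 ≤ (b - c) / b * g 0 := mul_nonneg (div_nonneg (sub_nonneg.2 hcb) hb.le) (hg 0).1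
  have h3 : 0 ≤ 1 / b * r⁻¹ := by positivity
  nlinarith [mul_le_mul_of_nonneg_left h1 h3, mul_le_mul_of_nonneg_right hr' h2]

/-- Substituting in the constant density stretches the range of integration to [0, r c] and brings
out r⁻¹. The longer range only helps as `g` is nonnegative, and the atom at 0 is not moved. -/
theorem le_integral_comp_mul_uniformType {c b r : ℝ} (hb : 0 < b) (hc : 0 ≤ c) (hcb : c ≤ b)
    (hr1 : 1 ≤ r) {g : ℝ → ℝ} (hm : Measurable g) (hg : ∀ t, g t ∈ Icc (0 : ℝ) 1) :
    r⁻¹ * ∫ t, g t ∂uniformType c b ≤ ∫ t, g (r * t) ∂uniformType c b := by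
  have hr : 0 < r := one_pos.trans_le hr1
  have hm' : Measurable fun t => g (r * t) := hm.comp (measurable_const_mul r)
  have hr' : r⁻¹ ≤ 1 := inv_le_one_of_one_le₀ hr1
  rw [integral_uniformType hb hcb (integrable_of_mem_unit hm' fun t => hg _),
    integral_uniformType hb hcb (integrable_of_mem_unit hm hg),
    ← intervalIntegral.integral_of_le (f := fun t => g (r * t)) hc,
    intervalIntegral.integral_comp_mul_left g hr.ne',
    mul_zero, smul_eq_mul, intervalIntegral.integral_of_le (by positivity)]
  have h1 : ∫ t in Ioc 0 c, g t ≤ ∫ t in Ioc 0 (r * c), g t := by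
    refine setIntegral_mono_set (integrable_of_mem_unit hm hg) (ae_of_all _ fun t => (hg t).1)
      (Ioc_subset_Ioc_right ?_).eventuallyLE
    nlinarith
  have h2 : 0 ≤ (b - c) / b * g 0 := mul_nonneg (div_nonneg (sub_nonneg.2 hcb) hb.le) (hg 0).1
  have h3 : 0 ≤ 1 / b * r⁻¹ := by positivity
  nlinarith [mul_le_mul_of_nonneg_left h1 h3, mul_le_mul_of_nonneg_right hr' h2]

/-! ### Winning probabilities in the Blotto game -/

theorem betaA_mem_unit {α : ℝ} (hα : α ∈ Icc (0 : ℝ) 1) (x y : ℝ) :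
    betaA α x y ∈ Icc (0 : ℝ) 1 := by
  unfold betaA
  split_ifs
  · simp
  · exact hα
  · simp

theorem measurable_uncurry_betaA (α : ℝ) : Measurable (Function.uncurry (betaA α)) := by
  unfold betaA Function.uncurry
  refine Measurable.ite (measurableSet_lt measurable_snd measurable_fst) measurable_const ?_
  exact Measurable.ite (measurableSet_eq_fun measurable_fst measurable_snd) measurable_const
    measurable_const

theorem measurable_betaA_right (α x : ℝ) : Measurable (betaA α x) :=
  (measurable_uncurry_betaA α).comp measurable_prodMk_left

theorem measurable_betaA_left (α y : ℝ) : Measurable fun x => betaA α x y :=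
  (measurable_uncurry_betaA α).comp measurable_prodMk_right

/-- The probability of winning with allocation `x` against a uniform-type law. -/
theorem integral_betaA_uniformType_le {α c q x : ℝ} (hα : α ∈ Icc (0 : ℝ) 1) (hq : 0 < q)
    (hcq : c ≤ q) (hx : 0 ≤ x) :
    ∫ t, betaA α x t ∂uniformType c q ≤ (q - c) / q + x / q := by
  rw [integral_uniformType hq hcq (integrable_of_mem_unit (measurable_betaA_right α x)
    fun t => betaA_mem_unit hα x t)]
  have h0 : 0 ≤ (q - c) / q := div_nonneg (sub_nonneg.2 hcq) hq.le
  have h1 : ∫ t in Ioc 0 c, betaA α x t ≤ x := by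
    calc ∫ t in Ioc 0 c, betaA α x t ≤ ∫ t in Ioc 0 c, (Iic x).indicator (fun _ => (1 : ℝ)) t := by
          refine integral_mono (integrable_of_mem_unit (measurable_betaA_right α x)
            fun t => betaA_mem_unit hα x t) ((integrable_const _).indicator measurableSet_Iic) ?_
          intro t
          by_cases h : t ≤ x
          · simpa [h] using (betaA_mem_unit hα x t).2
          · have h' : x < t := not_le.1 h
            simp [betaA, h'.ne, h'.not_gt, h]
      _ = (volume.restrict (Ioc 0 c)).real (Iic x) := by
          rw [integral_indicator_const _ measurableSet_Iic, smul_eq_mul, mul_one]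
      _ ≤ (volume : Measure ℝ).real (Ioc 0 x) := by
          rw [measureReal_restrict_apply measurableSet_Iic]
          refine measureReal_mono (fun t ht => ⟨ht.2.1, ht.1⟩) (by simp)
      _ = x := by simp [hx]
  have h2 := mul_le_mul_of_nonneg_left (betaA_mem_unit hα x 0).2 h0
  have h3 := mul_le_mul_of_nonneg_left h1 (by positivity : 0 ≤ 1 / q)
  calc _ ≤ (q - c) / q * 1 + 1 / q * x := add_le_add h2 h3
    _ = _ := by ring

/-- Equality case of the linear upper bound: a positive allocation inside the support beats the atom
at 0 and everything below it. -/
theorem le_integral_betaA_uniformType {α c q x : ℝ} (hα : α ∈ Icc (0 : ℝ) 1) (hq : 0 < q)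
    (hcq : c ≤ q) (hx : x ∈ Ioc 0 c) :
    (q - c) / q + x / q ≤ ∫ t, betaA α x t ∂uniformType c q := by
  rw [integral_uniformType hq hcq (integrable_of_mem_unit (measurable_betaA_right α x)
    fun t => betaA_mem_unit hα x t)]
  have h1 : x ≤ ∫ t in Ioc 0 c, betaA α x t := by
    calc x = (volume : Measure ℝ).real (Ioo 0 x) := by simp [hx.1.le]
      _ ≤ (volume.restrict (Ioc 0 c)).real (Iio x) := by
          rw [measureReal_restrict_apply measurableSet_Iio]
          refine measureReal_mono (fun t ht => ⟨ht.2, ht.1, ht.2.le.trans hx.2⟩) ?_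
          exact measure_ne_top_of_subset inter_subset_right (by simp)
      _ = ∫ t in Ioc 0 c, (Iio x).indicator (fun _ => (1 : ℝ)) t := by
          rw [integral_indicator_const _ measurableSet_Iio, smul_eq_mul, mul_one]
      _ ≤ ∫ t in Ioc 0 c, betaA α x t := by
          refine integral_mono ((integrable_const _).indicator measurableSet_Iio)
            (integrable_of_mem_unit (measurable_betaA_right α x)
              fun t => betaA_mem_unit hα x t) ?_
          intro t
          by_cases h : t < x
          · simp [betaA, h]
          · simpa [h] using (betaA_mem_unit hα x t).1
  have h0 : betaA α x 0 = 1 := by simp [betaA, hx.1]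
  have h3 := mul_le_mul_of_nonneg_left h1 (by positivity : 0 ≤ 1 / q)
  rw [h0]
  calc _ = (q - c) / q * 1 + 1 / q * x := by ring
    _ ≤ _ := by gcongr

/-- The probability of winning when both players draw from their uniform-type laws. -/
theorem le_integral_integral_betaA {α c p q : ℝ} (hα : α ∈ Icc (0 : ℝ) 1) (hc : 0 ≤ c)
    (hp : 0 < p) (hq : 0 < q) (hcp : c ≤ p) (hcq : c ≤ q) (hpq : c = p ∨ c = q) :
    (q - c) / q + c ^ 2 / (2 * p) / q ≤
      ∫ s, ∫ t, betaA α s t ∂uniformType c q ∂uniformType c p := by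
  have := uniformType_isProbabilityMeasure hq hc hcq
  have hmeas : Measurable fun s => ∫ t, betaA α s t ∂uniformType c q :=
    ((measurable_uncurry_betaA α).stronglyMeasurable.integral_prod_right).measurable
  have hunit : ∀ s, ∫ t, betaA α s t ∂uniformType c q ∈ Icc (0 : ℝ) 1 :=
    fun s => integral_mem_unit fun t => betaA_mem_unit hα s t
  rw [integral_uniformType hp hcp (integrable_of_mem_unit hmeas hunit)]
  have hint : Integrable (fun s : ℝ => (q - c) / q + s / q) (volume.restrict (Ioc 0 c)) := by
    refine Integrable.add (integrable_const _) (Integrable.div_const ?_ q)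
    exact (continuous_id.integrableOn_Icc).mono_set Ioc_subset_Icc_self
  have h1 : ∫ s in Ioc 0 c, ((q - c) / q + s / q) ≤
      ∫ s in Ioc 0 c, ∫ t, betaA α s t ∂uniformType c q :=
    setIntegral_mono_on hint (integrable_of_mem_unit hmeas hunit) measurableSet_Ioc
      fun s hs => le_integral_betaA_uniformType hα hq hcq hs
  have h2 : ∫ s in Ioc 0 c, ((q - c) / q + s / q) = c * ((q - c) / q) + c ^ 2 / 2 / q := by
    rw [← intervalIntegral.integral_of_le hc, intervalIntegral.integral_add (by simp)
      (by apply Continuous.intervalIntegrable; fun_prop),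
      intervalIntegral.integral_const, intervalIntegral.integral_div, integral_id]
    simp
  rw [h2] at h1
  -- A's own atom at 0 may be dropped without loss: if c = p it has no mass, and if c = q the
  -- opponent has no atom, so allocating 0 almost surely loses.
  have h3 : 0 ≤ (p - c) / p * ∫ t, betaA α 0 t ∂uniformType c q :=
    mul_nonneg (div_nonneg (sub_nonneg.2 hcp) hp.le) (hunit 0).1
  have h4 := mul_le_mul_of_nonneg_left h1 (by positivity : 0 ≤ 1 / p)
  refine le_trans (le_of_eq ?_) (h4.trans (le_add_of_nonneg_left h3))
  -- If c = p the factor c / p equals 1; if c = q the term with q - c vanishes.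
  rcases hpq with rfl | rfl
  · field_simp
  · field_simp; ring

/-! ### Concentration of the total and marginals after rescaling -/

/-- Hoeffding's inequality for a product of laws on `[0, c]`. -/
theorem measureReal_abs_sum_sub_ge_le {n : ℕ} {M : Fin n → Measure ℝ}
    [∀ i, IsProbabilityMeasure (M i)] {c X r : ℝ} (hM : ∀ i, ∀ᵐ t ∂M i, t ∈ Icc 0 c)
    (hX : ∑ i, ∫ t, t ∂M i = X) (hr : 0 ≤ r) :
    (Measure.pi M).real {a | r ≤ |∑ i, a i - X|} ≤ 2 * Real.exp (-(2 * r ^ 2 / (n * c ^ 2))) := by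
  have hmean : ∀ i, ∫ a, a i ∂Measure.pi M = ∫ t, t ∂M i := fun i =>
    integral_comp_eval (μ := M) (i := i) (f := fun t : ℝ => t) measurable_id.aestronglyMeasurable
  have hsub : ∀ i, ProbabilityTheory.HasSubgaussianMGF (fun a : Fin n → ℝ => a i - ∫ t, t ∂M i)
      ((‖c - 0‖₊ / 2) ^ 2) (Measure.pi M) := by
    intro i
    rw [← hmean i]
    exact ProbabilityTheory.hasSubgaussianMGF_of_mem_Icc (measurable_pi_apply i).aemeasurable
      ((Measure.quasiMeasurePreserving_eval M i).ae (hM i))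
  have hind : ProbabilityTheory.iIndepFun
      (fun i (a : Fin n → ℝ) => a i - ∫ t, t ∂M i) (Measure.pi M) :=
    ProbabilityTheory.iIndepFun_pi (X := fun i t => t - ∫ t, t ∂M i)
      fun i => (measurable_id.sub_const _).aemeasurable
  have hindneg : ProbabilityTheory.iIndepFun
      (fun i (a : Fin n → ℝ) => -(a i - ∫ t, t ∂M i)) (Measure.pi M) :=
    ProbabilityTheory.iIndepFun_pi (X := fun i t => -(t - ∫ t, t ∂M i))
      fun i => (measurable_id.sub_const _).neg.aemeasurable
  have h1 := ProbabilityTheory.HasSubgaussianMGF.measure_sum_ge_le_of_iIndepFun hind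
    (s := Finset.univ) (fun i _ => hsub i) hr
  have h2 := ProbabilityTheory.HasSubgaussianMGF.measure_sum_ge_le_of_iIndepFun hindneg
    (s := Finset.univ) (fun i _ => (hsub i).neg) hr
  -- A variable in an interval of length c has sub-Gaussian parameter (c / 2)²; there are n of them.
  have hexp : -r ^ 2 / (2 * ((∑ _i : Fin n, (‖c - 0‖₊ / 2) ^ 2 : NNReal) : ℝ)) =
      -(2 * r ^ 2 / (n * c ^ 2)) := by
    simp only [sub_zero, Finset.sum_const, Finset.card_univ, Fintype.card_fin, nsmul_eq_mul]
    push_cast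
    rw [div_pow, Real.norm_eq_abs, sq_abs]
    ring
  push_cast at h1 h2 hexp
  rw [hexp] at h1 h2
  have hset : {a : Fin n → ℝ | r ≤ |∑ i, a i - X|} ⊆
      {a | r ≤ ∑ i, (a i - ∫ t, t ∂M i)} ∪ {a | r ≤ ∑ i, -(a i - ∫ t, t ∂M i)} := by
    intro a ha
    simp only [mem_ofPred_eq, mem_union, Finset.sum_neg_distrib, Finset.sum_sub_distrib, hX] at ha ⊢
    exact le_abs.1 ha
  calc _ ≤ _ := measureReal_mono hset
    _ ≤ _ := measureReal_union_le _ _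
    _ ≤ _ := by linarith

/-- The law `P` is `η`-close to `M` when tested against monotone functions into `[0, 1]`. -/
def MonotoneClose (P M : Measure ℝ) (η : ℝ) : Prop :=
  ∀ g : ℝ → ℝ, (Monotone g ∨ Antitone g) → (∀ t, g t ∈ Icc (0 : ℝ) 1) →
    |∫ t, g t ∂P - ∫ t, g t ∂M| ≤ η

theorem measurable_of_monotone_or_antitone {g : ℝ → ℝ} (hg : Monotone g ∨ Antitone g) :
    Measurable g :=
  hg.elim Monotone.measurable Antitone.measurable

/-- Passing from `g` to 1 - g exchanges the two kinds of monotonicity and keeps the distance of the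
integrals. -/
theorem MonotoneClose.of_antitone {P M : Measure ℝ} [IsProbabilityMeasure P]
    [IsProbabilityMeasure M] {η : ℝ}
    (h : ∀ g : ℝ → ℝ, Antitone g → (∀ t, g t ∈ Icc (0 : ℝ) 1) →
      |∫ t, g t ∂P - ∫ t, g t ∂M| ≤ η) : MonotoneClose P M η := by
  rintro g (hg | hg) hu
  · have h1 := h (fun t => 1 - g t) (fun s t hst => sub_le_sub_left (hg hst) 1)
      fun t => ⟨sub_nonneg.2 (hu t).2, sub_le_self _ (hu t).1⟩
    rw [integral_sub (integrable_const _) (integrable_of_mem_unit hg.measurable hu),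
      integral_sub (integrable_const _) (integrable_of_mem_unit hg.measurable hu)] at h1
    simp only [integral_const, probReal_univ, smul_eq_mul, mul_one, sub_sub_sub_cancel_left] at h1
    rwa [abs_sub_comm]
  · exact h g hg hu

theorem integral_le_add_measureReal_compl {α : Type*} [MeasurableSpace α] {μ : Measure α}
    [IsProbabilityMeasure μ] {f g : α → ℝ} {E : Set α} (hE : MeasurableSet E)
    (hf : Measurable f) (hfu : ∀ t, f t ∈ Icc (0 : ℝ) 1)
    (hg : Measurable g) (hgu : ∀ t, g t ∈ Icc (0 : ℝ) 1)
    (h : ∀ᵐ t ∂μ, t ∉ E → f t ≤ g t) :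
    ∫ t, f t ∂μ ≤ ∫ t, g t ∂μ + μ.real E := by
  calc ∫ t, f t ∂μ ≤ ∫ t, (g t + E.indicator (fun _ => (1 : ℝ)) t) ∂μ := by
        refine integral_mono_ae (integrable_of_mem_unit hf hfu)
          ((integrable_of_mem_unit hg hgu).add ((integrable_const _).indicator hE)) ?_
        filter_upwards [h] with t ht
        by_cases hE' : t ∈ E
        · have := (hfu t).2
          have := (hgu t).1
          simp only [hE', indicator_of_mem]; linarith
        · simpa [hE'] using ht hE'
    _ = ∫ t, g t ∂μ + μ.real E := by
        rw [integral_add (integrable_of_mem_unit hg hgu) ((integrable_const _).indicator hE),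
          integral_indicator_const _ hE, smul_eq_mul, mul_one]

/-- The marginals of the rescaled product of uniform-type laws are close to these laws. -/
theorem monotoneClose_map_rescale {n : ℕ} {c b : Fin n → ℝ} (hb : ∀ i, 0 < b i)
    (hc : ∀ i, 0 ≤ c i) (hcb : ∀ i, c i ≤ b i) {X τ ρ : ℝ} (hX : 0 < X) (hτ : 0 ≤ τ)
    (hτ1 : τ < 1)
    (hρ : (Measure.pi fun i => uniformType (c i) (b i)).real {a | τ * X ≤ |∑ i, a i - X|} ≤ ρ)
    (i : Fin n) :
    MonotoneClose
      (((Measure.pi fun i => uniformType (c i) (b i)).map (rescale X)).map fun x => x i)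
      (uniformType (c i) (b i)) (τ + ρ) := by
  have hprob : ∀ i, IsProbabilityMeasure (uniformType (c i) (b i)) :=
    fun i => uniformType_isProbabilityMeasure (hb i) (hc i) (hcb i)
  set μ := Measure.pi fun i => uniformType (c i) (b i) with hμ
  have hmr := measurable_rescale (n := n) X
  have hmi : Measurable fun x : Fin n → ℝ => x i := measurable_pi_apply i
  have : IsProbabilityMeasure (μ.map (rescale X)) := Measure.isProbabilityMeasure_map hmr.aemeasurable
  have : IsProbabilityMeasure ((μ.map (rescale X)).map fun x => x i) :=
    Measure.isProbabilityMeasure_map hmi.aemeasurable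
  -- For antitone `g` the upper bound contracts the argument and the lower bound dilates it, which
  -- are the directions in which the scaling estimates hold.
  refine MonotoneClose.of_antitone fun g hg hu => ?_
  have hgm := hg.measurable
  rw [Measure.map_map hmi hmr, integral_map (hmi.comp hmr).aemeasurable hgm.aestronglyMeasurable]
  have hpull : ∀ r : ℝ, ∫ t, g (r * t) ∂uniformType (c i) (b i) = ∫ a, g (r * a i) ∂μ :=
    fun r => (integral_comp_eval (μ := fun i => uniformType (c i) (b i)) (i := i)
      (f := fun t => g (r * t)) (hgm.comp (measurable_const_mul r)).aestronglyMeasurable).symm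
  have hE : MeasurableSet {a : Fin n → ℝ | τ * X ≤ |∑ i, a i - X|} := by
    refine measurableSet_le measurable_const ?_
    exact ((Finset.measurable_sum _ fun j _ => measurable_pi_apply j).sub_const X).abs
  have hnn : ∀ᵐ a ∂μ, 0 ≤ a i := by
    have := (Measure.quasiMeasurePreserving_eval (fun i => uniformType (c i) (b i)) i).ae
      (ae_mem_Icc_uniformType (hc i))
    filter_upwards [this] with a ha using ha.1
  have hscale : ∀ a : Fin n → ℝ, 0 ≤ a i → a ∉ {a : Fin n → ℝ | τ * X ≤ |∑ i, a i - X|} →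
      (1 + τ)⁻¹ * a i ≤ rescale X a i ∧ rescale X a i ≤ (1 - τ)⁻¹ * a i := by
    intro a ha hna
    simp only [mem_ofPred_eq, not_le, abs_lt] at hna
    -- As τ < 1, the total is positive off the bad event, so the default value 0 of `rescale` plays
    -- no role there.
    have hS : 0 < ∑ j, a j := by nlinarith
    have hr : rescale X a i = (X / ∑ j, a j) * a i := by
      rw [rescale, if_neg hS.ne']; ring
    rw [hr]
    constructor <;> refine mul_le_mul_of_nonneg_right ?_ ha
    · rw [inv_eq_one_div, div_le_div_iff₀ (by linarith) hS]; linarith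
    · rw [inv_eq_one_div, div_le_div_iff₀ hS (by linarith)]; linarith
  have hmg : Measurable fun a => g (rescale X a i) := hgm.comp (hmi.comp hmr)
  have hms : ∀ r : ℝ, Measurable fun a : Fin n → ℝ => g (r * a i) := fun r =>
    hgm.comp (hmi.const_mul r)
  have h1 : ∫ a, g (rescale X a i) ∂μ ≤ ∫ a, g ((1 + τ)⁻¹ * a i) ∂μ + ρ := by
    refine (integral_le_add_measureReal_compl hE hmg (fun _ => hu _) (hms _) (fun _ => hu _)
      ?_).trans (add_le_add_right hρ _)
    filter_upwards [hnn] with a ha hna using hg (hscale a ha hna).1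
  have h2 : ∫ a, g ((1 - τ)⁻¹ * a i) ∂μ ≤ ∫ a, g (rescale X a i) ∂μ + ρ := by
    refine (integral_le_add_measureReal_compl hE (hms _) (fun _ => hu _) hmg (fun _ => hu _)
      ?_).trans (add_le_add_right hρ _)
    filter_upwards [hnn] with a ha hna using hg (hscale a ha hna).2
  rw [← hpull] at h1 h2
  have h3 := integral_comp_mul_uniformType_le (hb i) (hc i) (hcb i) (r := (1 + τ)⁻¹)
    (by positivity) (inv_le_one_of_one_le₀ (by linarith)) hgm hu
  have h4 := le_integral_comp_mul_uniformType (hb i) (hc i) (hcb i) (r := (1 - τ)⁻¹)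
    ((one_le_inv₀ (by linarith)).2 (by linarith)) hgm hu
  rw [inv_inv] at h3 h4
  have h5 := integral_mem_unit (μ := uniformType (c i) (b i)) hu
  have h6 : τ * ∫ t, g t ∂uniformType (c i) (b i) ≤ τ := mul_le_of_le_one_right hτ h5.2
  rw [abs_le]
  change -(τ + ρ) ≤ ∫ a, g (rescale X a i) ∂μ - _ ∧ ∫ a, g (rescale X a i) ∂μ - _ ≤ τ + ρ
  constructor <;> linarith

/-! ### Payoff functions that are monotone in each allocation -/

/-- A function of two allocations with values in `[0, 1]` that is monotone in each of them. -/
structure UnitMonotone (H : ℝ → ℝ → ℝ) : Prop where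
  mem_unit : ∀ x y, H x y ∈ Icc (0 : ℝ) 1
  left : (∀ y, Monotone fun x => H x y) ∨ (∀ y, Antitone fun x => H x y)
  right : (∀ x, Monotone (H x)) ∨ (∀ x, Antitone (H x))

namespace UnitMonotone

variable {H : ℝ → ℝ → ℝ}

theorem left_apply (hH : UnitMonotone H) (y : ℝ) :
    Monotone (fun x => H x y) ∨ Antitone (fun x => H x y) :=
  hH.left.imp (fun h => h y) (fun h => h y)

theorem right_apply (hH : UnitMonotone H) (x : ℝ) : Monotone (H x) ∨ Antitone (H x) :=
  hH.right.imp (fun h => h x) (fun h => h x)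

theorem measurable_left (hH : UnitMonotone H) (y : ℝ) : Measurable fun x => H x y :=
  measurable_of_monotone_or_antitone (hH.left_apply y)

theorem measurable_right (hH : UnitMonotone H) (x : ℝ) : Measurable (H x) :=
  measurable_of_monotone_or_antitone (hH.right_apply x)

theorem integrable_left (hH : UnitMonotone H) (P : Measure ℝ) [IsFiniteMeasure P] (y : ℝ) :
    Integrable (fun x => H x y) P :=
  integrable_of_mem_unit (hH.measurable_left y) fun x => hH.mem_unit x y

/-- Averaging over one variable preserves monotonicity in the other. This gives measurability of the
iterated integral without joint measurability, and makes the average an admissible test function for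
`MonotoneClose`. -/
theorem monotone_or_antitone_integral (hH : UnitMonotone H) (P : Measure ℝ) [IsFiniteMeasure P] :
    Monotone (fun y => ∫ x, H x y ∂P) ∨ Antitone (fun y => ∫ x, H x y ∂P) :=
  hH.right.imp
    (fun h _ _ hst => integral_mono (hH.integrable_left P _) (hH.integrable_left P _)
      fun x => h x hst)
    (fun h _ _ hst => integral_mono (hH.integrable_left P _) (hH.integrable_left P _)
      fun x => h x hst)

theorem measurable_integral (hH : UnitMonotone H) (P : Measure ℝ) [IsFiniteMeasure P] :
    Measurable fun y => ∫ x, H x y ∂P :=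
  measurable_of_monotone_or_antitone (hH.monotone_or_antitone_integral P)

theorem integral_mem_unit (hH : UnitMonotone H) (P : Measure ℝ) [IsProbabilityMeasure P] (y : ℝ) :
    ∫ x, H x y ∂P ∈ Icc (0 : ℝ) 1 :=
  LotteryBlotto.integral_mem_unit fun x => hH.mem_unit x y

/-- The expectation of a separable payoff depends only on the marginals. -/
theorem integral_integral_sum {n : ℕ} (hH : UnitMonotone H) (w : Fin n → ℝ)
    (s t : Measure (Fin n → ℝ)) [IsProbabilityMeasure s] [IsProbabilityMeasure t] :
    ∫ y, ∫ x, ∑ i, w i * H (x i) (y i) ∂s ∂t =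
      ∑ i, w i * ∫ y, ∫ x, H x y ∂(s.map fun x => x i) ∂(t.map fun y => y i) := by
  have hmi : ∀ i, Measurable fun x : Fin n → ℝ => x i := measurable_pi_apply
  have hs : ∀ i, IsProbabilityMeasure (s.map fun x => x i) := fun i =>
    Measure.isProbabilityMeasure_map (hmi i).aemeasurable
  have hin : ∀ y : Fin n → ℝ, ∫ x, ∑ i, w i * H (x i) (y i) ∂s =
      ∑ i, w i * ∫ x, H x (y i) ∂(s.map fun x => x i) := by
    intro y
    rw [integral_finsetSum]
    · refine Finset.sum_congr rfl fun i _ => ?_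
      rw [integral_const_mul, integral_map (hmi i).aemeasurable
        (hH.measurable_left (y i)).aestronglyMeasurable]
    · intro i _
      exact (integrable_of_mem_unit ((hH.measurable_left (y i)).comp (hmi i))
        fun x => hH.mem_unit _ _).const_mul _
  simp_rw [hin]
  rw [integral_finsetSum]
  · refine Finset.sum_congr rfl fun i _ => ?_
    rw [integral_const_mul, integral_map (hmi i).aemeasurable
      (hH.measurable_integral _).aestronglyMeasurable]
  · intro i _
    exact (integrable_of_mem_unit ((hH.measurable_integral _).comp (hmi i))
      fun y => hH.integral_mem_unit _ _).const_mul _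

/-- Three replacements: β by `H` while both laws are still uniform-type (cost e, only there is
`hfar` available), then N by Q and M by P (cost η each, by monotonicity of `H`). -/
theorem le_integral_integral {β : ℝ → ℝ → ℝ} (hH : UnitMonotone H)
    (hβm : Measurable (Function.uncurry β)) (hβ : ∀ x y, β x y ∈ Icc (0 : ℝ) 1)
    {P Q M N : Measure ℝ} [IsProbabilityMeasure P] [IsProbabilityMeasure M]
    [IsProbabilityMeasure N] {η e T : ℝ} (hP : MonotoneClose P M η) (hQ : MonotoneClose Q N η)
    [IsProbabilityMeasure Q] (hN : ∀ᵐ y ∂N, y ∈ Icc 0 T)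
    (hfar : ∀ y ∈ Icc 0 T, |∫ x, H x y ∂M - ∫ x, β x y ∂M| ≤ e) :
    ∫ y, ∫ x, β x y ∂M ∂N ≤ ∫ y, ∫ x, H x y ∂P ∂Q + (2 * η + e) := by
  have hβi : Integrable (fun y => ∫ x, β x y ∂M) N :=
    integrable_of_mem_unit hβm.stronglyMeasurable.integral_prod_left'.measurable
      fun y => LotteryBlotto.integral_mem_unit fun x => hβ x y
  have hHi : ∀ (μ ν : Measure ℝ) [IsProbabilityMeasure μ] [IsProbabilityMeasure ν],
      Integrable (fun y => ∫ x, H x y ∂μ) ν := fun μ ν _ _ =>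
    integrable_of_mem_unit (hH.measurable_integral μ) (hH.integral_mem_unit μ)
  have h1 : ∫ y, ∫ x, β x y ∂M ∂N ≤ ∫ y, (∫ x, H x y ∂M + e) ∂N := by
    refine integral_mono_ae hβi ((hHi M N).add (integrable_const _)) ?_
    filter_upwards [hN] with y hy
    have := (abs_le.1 (hfar y hy)).1
    linarith
  have h2 := (abs_le.1 (hQ _ (hH.monotone_or_antitone_integral M) (hH.integral_mem_unit M))).1
  have h3 : ∫ y, ∫ x, H x y ∂M ∂Q ≤ ∫ y, (∫ x, H x y ∂P + η) ∂Q := by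
    refine integral_mono (hHi M Q) ((hHi P Q).add (integrable_const _)) fun y => ?_
    have := (abs_le.1 (hP _ (hH.left_apply y) fun x => hH.mem_unit x y)).1
    simp only
    linarith
  rw [integral_add (hHi M N) (integrable_const _)] at h1
  rw [integral_add (hHi P Q) (integrable_const _)] at h3
  simp only [integral_const, probReal_univ, smul_eq_mul, one_mul] at h1 h3
  linarith

end UnitMonotone

/-- The integrand differs by less than ε off the far set and by at most 1 on it. -/
theorem abs_integral_sub_le_of_measureReal_le {M : Measure ℝ} [IsProbabilityMeasure M]
    {φ β : ℝ → ℝ} (hφm : Measurable φ) (hφ : ∀ t, φ t ∈ Icc (0 : ℝ) 1)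
    (hβm : Measurable β) (hβ : ∀ t, β t ∈ Icc (0 : ℝ) 1) {T ε δ : ℝ}
    (hM : ∀ᵐ t ∂M, t ∈ Icc 0 T) (hε : 0 ≤ ε)
    (hfar : M.real {t | t ∈ Icc 0 T ∧ ε ≤ |φ t - β t|} ≤ δ) :
    |∫ t, φ t ∂M - ∫ t, β t ∂M| ≤ ε + δ := by
  set F := {t | t ∈ Icc 0 T ∧ ε ≤ |φ t - β t|} with hF
  have hFm : MeasurableSet F :=
    measurableSet_Icc.inter (measurableSet_le measurable_const (hφm.sub hβm).abs)
  have hφi := integrable_of_mem_unit (μ := M) hφm hφ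
  have hβi := integrable_of_mem_unit (μ := M) hβm hβ
  rw [← integral_sub hφi hβi]
  calc |∫ t, (φ t - β t) ∂M| ≤ ∫ t, |φ t - β t| ∂M := abs_integral_le_integral_abs
    _ ≤ ∫ t, (ε + F.indicator (fun _ => (1 : ℝ)) t) ∂M := by
        refine integral_mono_ae (hφi.sub hβi).abs
          ((integrable_const _).add ((integrable_const _).indicator hFm)) ?_
        filter_upwards [hM] with t ht
        by_cases h : t ∈ F
        · have : |φ t - β t| ≤ 1 := by
            rw [abs_le]
            constructor <;> linarith [(hφ t).1, (hφ t).2, (hβ t).1, (hβ t).2]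
          simp only [h, indicator_of_mem]; linarith
        · have : |φ t - β t| < ε := by
            by_contra hcon
            exact h ⟨ht, not_lt.1 hcon⟩
          simpa [h] using this.le
    _ = ε + M.real F := by
        rw [integral_add (integrable_const _) ((integrable_const _).indicator hFm),
          integral_indicator_const _ hFm]
        simp
    _ ≤ ε + δ := by gcongr

/-- The equilibrium principle: when all marginal values w_i / q_i equal κ, the linear bound sees an
allocation only through its total, so no allocation gains over one that spends the expected budget.
Here u is the deviation payoff, v the equilibrium payoff, m the means. -/
theorem sum_mul_le_of_indifferent {n : ℕ} {w q k m x u v : Fin n → ℝ} {κ e e' : ℝ}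
    (hw : ∀ i, 0 ≤ w i) (hκ : 0 ≤ κ) (hq : ∀ i, w i / q i = κ) (hx : ∑ i, x i ≤ ∑ i, m i)
    (hu : ∀ i, u i ≤ k i + x i / q i + e) (hv : ∀ i, k i + m i / q i ≤ v i + e') :
    ∑ i, w i * u i ≤ ∑ i, w i * v i + (e + e') * ∑ i, w i := by
  have h1 : ∑ i, w i * u i ≤ ∑ i, (w i * k i + e * w i) + κ * ∑ i, x i := by
    rw [Finset.mul_sum, ← Finset.sum_add_distrib]
    refine Finset.sum_le_sum fun i _ => (mul_le_mul_of_nonneg_left (hu i) (hw i)).trans_eq ?_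
    rw [← hq i]; ring
  have h2 : ∑ i, (w i * k i + e * w i) + κ * ∑ i, m i ≤
      ∑ i, w i * v i + (e + e') * ∑ i, w i := by
    rw [Finset.mul_sum, Finset.mul_sum, ← Finset.sum_add_distrib, ← Finset.sum_add_distrib]
    refine Finset.sum_le_sum fun i _ => ?_
    have := mul_le_mul_of_nonneg_left (hv i) (hw i)
    rw [← hq i]
    calc _ = w i * (k i + m i / q i) + e * w i := by ring
      _ ≤ w i * (v i + e') + e * w i := by gcongr
      _ = _ := by ring
  have h3 := mul_le_mul_of_nonneg_left hx hκ
  linarith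

/-! ### Contest success functions on the whole plane -/

namespace CSFPair

variable (ζ : CSFPair)

/-- The contest success function of A, extended to the plane by projecting to `[0, ∞)²`. -/
def extA (ζ : CSFPair) (x y : ℝ) : ℝ := ζ.A (max x 0) (max y 0)

def extB (ζ : CSFPair) (x y : ℝ) : ℝ := ζ.B (max x 0) (max y 0)

theorem extA_of_nonneg {x y : ℝ} (hx : 0 ≤ x) (hy : 0 ≤ y) : ζ.extA x y = ζ.A x y := by
  rw [extA, max_eq_left hx, max_eq_left hy]

theorem extB_of_nonneg {x y : ℝ} (hx : 0 ≤ x) (hy : 0 ≤ y) : ζ.extB x y = ζ.B x y := by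
  rw [extB, max_eq_left hx, max_eq_left hy]

theorem unitMonotone_extA : UnitMonotone ζ.extA where
  mem_unit x y := by
    have h1 := ζ.nonneg_B _ _ (le_max_right x 0) (le_max_right y 0)
    have h2 := ζ.add_eq_one _ _ (le_max_right x 0) (le_max_right y 0)
    exact ⟨ζ.nonneg_A _ _ (le_max_right x 0) (le_max_right y 0), by unfold extA; linarith⟩
  left := .inl fun y _ _ h => ζ.A_mono_left _ (le_max_right y 0) (mem_Ici.2 (le_max_right _ 0))
    (mem_Ici.2 (le_max_right _ 0)) (max_le_max_right 0 h)
  right := .inr fun x _ _ h => ζ.A_anti_right _ (le_max_right x 0) (mem_Ici.2 (le_max_right _ 0))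
    (mem_Ici.2 (le_max_right _ 0)) (max_le_max_right 0 h)

theorem unitMonotone_extB : UnitMonotone ζ.extB where
  mem_unit x y := by
    have h1 := ζ.nonneg_A _ _ (le_max_right x 0) (le_max_right y 0)
    have h2 := ζ.add_eq_one _ _ (le_max_right x 0) (le_max_right y 0)
    exact ⟨ζ.nonneg_B _ _ (le_max_right x 0) (le_max_right y 0), by unfold extB; linarith⟩
  left := .inr fun y _ _ h => ζ.B_anti_left _ (le_max_right y 0) (mem_Ici.2 (le_max_right _ 0))
    (mem_Ici.2 (le_max_right _ 0)) (max_le_max_right 0 h)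
  right := .inl fun x _ _ h => ζ.B_mono_right _ (le_max_right x 0) (mem_Ici.2 (le_max_right _ 0))
    (mem_Ici.2 (le_max_right _ 0)) (max_le_max_right 0 h)

end CSFPair

theorem betaB_eq (α x y : ℝ) : betaB α x y = betaA (1 - α) y x := rfl

theorem betaA_add_betaB (α x y : ℝ) : betaA α x y + betaB α x y = 1 := by
  unfold betaA betaB
  rcases lt_trichotomy x y with h | h | h
  · simp [h, h.not_gt, h.ne]
  · simp [h]
  · simp [h, h.not_gt, h.ne]

theorem betaB_mem_unit {α : ℝ} (hα : α ∈ Icc (0 : ℝ) 1) (x y : ℝ) :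
    betaB α x y ∈ Icc (0 : ℝ) 1 :=
  betaA_mem_unit ⟨sub_nonneg.2 hα.2, sub_le_self _ hα.1⟩ y x

theorem measurable_uncurry_betaB (α : ℝ) : Measurable (Function.uncurry (betaB α)) :=
  (measurable_uncurry_betaA (1 - α)).comp measurable_swap

/-- Both pairs sum to 1. Needed because Δ tests A's laws only with ζ_A and B's laws only with ζ_B,
while a deviation of one player is averaged over the other player's laws. -/
theorem CSFPair.abs_sub_betaA_eq (ζ : CSFPair) (α : ℝ) {x y : ℝ} (hx : 0 ≤ x) (hy : 0 ≤ y) :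
    |ζ.A x y - betaA α x y| = |ζ.B x y - betaB α x y| := by
  have h1 := ζ.add_eq_one x y hx hy
  have h2 := betaA_add_betaB α x y
  rw [abs_sub_comm]
  congr 1
  linarith

/-! ### Payoffs in terms of marginals -/

namespace Game

variable {n : ℕ} {XA XB : ℝ} (G : Game n XA XB)

theorem payoffA_eq (ζ : CSFPair) {s t : Measure (Fin n → ℝ)} [IsProbabilityMeasure s]
    [IsProbabilityMeasure t] (hs : ∀ᵐ x ∂s, ∀ i, 0 ≤ x i) (ht : ∀ᵐ y ∂t, ∀ i, 0 ≤ y i) :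
    G.payoffA ζ s t =
      ∑ i, G.wA i * ∫ y, ∫ x, ζ.extA x y ∂(s.map fun x => x i) ∂(t.map fun y => y i) := by
  rw [← ζ.unitMonotone_extA.integral_integral_sum, payoffA]
  refine integral_congr_ae ?_
  filter_upwards [ht] with y hy
  refine integral_congr_ae ?_
  filter_upwards [hs] with x hx
  exact Finset.sum_congr rfl fun i _ => by rw [ζ.extA_of_nonneg (hx i) (hy i)]

theorem payoffB_eq (ζ : CSFPair) {s t : Measure (Fin n → ℝ)} [IsProbabilityMeasure s]
    [IsProbabilityMeasure t] (hs : ∀ᵐ x ∂s, ∀ i, 0 ≤ x i) (ht : ∀ᵐ y ∂t, ∀ i, 0 ≤ y i) :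
    G.payoffB ζ s t =
      ∑ i, G.wB i * ∫ y, ∫ x, ζ.extB x y ∂(s.map fun x => x i) ∂(t.map fun y => y i) := by
  rw [← ζ.unitMonotone_extB.integral_integral_sum, payoffB]
  refine integral_congr_ae ?_
  filter_upwards [ht] with y hy
  refine integral_congr_ae ?_
  filter_upwards [hs] with x hx
  exact Finset.sum_congr rfl fun i _ => by rw [ζ.extB_of_nonneg (hx i) (hy i)]

/-- Every profile is an approximate equilibrium if the gain may be the total value. -/
theorem deviationGainLe_of_one_le (ζ : CSFPair) {s t : Measure (Fin n → ℝ)}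
    [IsProbabilityMeasure s] [IsProbabilityMeasure t] (hs : ∀ᵐ x ∂s, ∀ i, 0 ≤ x i)
    (ht : ∀ᵐ y ∂t, ∀ i, 0 ≤ y i) {η : ℝ} (hη : 1 ≤ η) : G.DeviationGainLe ζ s t η := by
  have hmi : ∀ i, Measurable fun x : Fin n → ℝ => x i := measurable_pi_apply
  have hmap : ∀ (s : Measure (Fin n → ℝ)) [IsProbabilityMeasure s] (i : Fin n),
      IsProbabilityMeasure (s.map fun x => x i) := fun s _ i =>
    Measure.isProbabilityMeasure_map (hmi i).aemeasurable
  have key : ∀ (H : ℝ → ℝ → ℝ) (_ : UnitMonotone H) (w : Fin n → ℝ) (_ : ∀ i, 0 < w i)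
      (s t s' t' : Measure (Fin n → ℝ)) [IsProbabilityMeasure s] [IsProbabilityMeasure t]
      [IsProbabilityMeasure s'] [IsProbabilityMeasure t'],
      ∑ i, w i * ∫ y, ∫ x, H x y ∂(s.map fun x => x i) ∂(t.map fun y => y i) ≤
      ∑ i, w i * ∫ y, ∫ x, H x y ∂(s'.map fun x => x i) ∂(t'.map fun y => y i) +
        η * ∑ i, w i := by
    intro H hH w hw s t s' t' _ _ _ _
    rw [Finset.mul_sum, ← Finset.sum_add_distrib]
    refine Finset.sum_le_sum fun i _ => ?_
    have h1 := (integral_mem_unit (μ := t.map fun y => y i)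
      (hH.integral_mem_unit (s.map fun x => x i))).2
    have h2 := (integral_mem_unit (μ := t'.map fun y => y i)
      (hH.integral_mem_unit (s'.map fun x => x i))).1
    nlinarith [hw i, mul_le_mul_of_nonneg_left h1 (hw i).le, mul_nonneg (hw i).le h2]
  constructor
  · intro x hx
    have hd : ∀ᵐ x' ∂Measure.dirac x, ∀ i, 0 ≤ x' i := by rw [ae_dirac_eq]; exact hx.1
    rw [G.payoffA_eq ζ hd ht, G.payoffA_eq ζ hs ht]
    exact key _ ζ.unitMonotone_extA _ G.wA_pos _ _ _ _
  · intro y hy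
    have hd : ∀ᵐ y' ∂Measure.dirac y, ∀ i, 0 ≤ y' i := by rw [ae_dirac_eq]; exact hy.1
    rw [G.payoffB_eq ζ hs hd, G.payoffB_eq ζ hs ht]
    exact key _ ζ.unitMonotone_extB _ G.wB_pos _ _ _ _

/-! ### The constants λ, the supports and the expected budgets -/

theorem WA_pos [NeZero n] : 0 < G.WA :=
  Finset.sum_pos (fun i _ => G.wA_pos i) Finset.univ_nonempty

theorem WB_pos [NeZero n] : 0 < G.WB :=
  Finset.sum_pos (fun i _ => G.wB_pos i) Finset.univ_nonempty

theorem vA_pos [NeZero n] (i : Fin n) : 0 < G.vA i := div_pos (G.wA_pos i) G.WA_pos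

theorem vB_pos [NeZero n] (i : Fin n) : 0 < G.vB i := div_pos (G.wB_pos i) G.WB_pos

theorem sum_add_sum_compl_pos [NeZero n] {f g : Fin n → ℝ} (S : Finset (Fin n)) {s t : ℝ}
    (hs : 0 < s) (ht : 0 < t) (hf : ∀ i, 0 < f i) (hg : ∀ i, 0 < g i) :
    0 < s * ∑ i ∈ S, f i + t * ∑ i ∈ Sᶜ, g i := by
  have h1 : 0 ≤ ∑ i ∈ S, f i := Finset.sum_nonneg fun i _ => (hf i).le
  have h2 : 0 ≤ ∑ i ∈ Sᶜ, g i := Finset.sum_nonneg fun i _ => (hg i).le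
  by_cases h : (0 : Fin n) ∈ S
  · have : 0 < ∑ i ∈ S, f i := Finset.sum_pos (fun i _ => hf i) ⟨0, h⟩
    positivity
  · have : 0 < ∑ i ∈ Sᶜ, g i := Finset.sum_pos (fun i _ => hg i) ⟨0, Finset.mem_compl.2 h⟩
    positivity

theorem lamA_pos [NeZero n] (hXB : 0 < XB) {γ : ℝ} (hγ : 0 < γ) : 0 < G.lamA γ :=
  sum_add_sum_compl_pos _ (by positivity) (by positivity)
    (fun i => div_pos (pow_pos (G.vB_pos i) 2) (G.vA_pos i)) G.vA_pos

theorem lamB_pos [NeZero n] (hXA : 0 < XA) {γ : ℝ} (hγ : 0 < γ) : 0 < G.lamB γ :=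
  sum_add_sum_compl_pos _ (by positivity) (by positivity) G.vB_pos
    (fun i => div_pos (pow_pos (G.vA_pos i) 2) (G.vB_pos i))

/-- Numerator and denominator of the defining equation are 2 X_B λ_A and 2 X_A λ_B, so the budgets
cancel. -/
theorem eq_lamA_div_lamB [NeZero n] (hXA : 0 < XA) (hXB : 0 < XB) {γ : ℝ}
    (hγ : γ ∈ G.Solutions) : γ = G.lamA γ / G.lamB γ := by
  obtain ⟨hγ0, h⟩ := hγ
  have hB := G.lamB_pos hXA hγ0
  have h1 : γ ^ 2 * ∑ i ∈ G.Omega γ, G.vB i ^ 2 / G.vA i + ∑ i ∈ (G.Omega γ)ᶜ, G.vA i =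
      2 * XB * G.lamA γ := by
    unfold lamA; field_simp
  have h2 : ∑ i ∈ G.Omega γ, G.vB i + 1 / γ ^ 2 * ∑ i ∈ (G.Omega γ)ᶜ, G.vA i ^ 2 / G.vB i =
      2 * XA * G.lamB γ := by
    unfold lamB; field_simp
  rw [h1, h2] at h
  field_simp at h ⊢
  linarith

/-- The upper end of the support of the uniform-type laws on battlefield `i`. -/
noncomputable def supp (γ : ℝ) (i : Fin n) : ℝ := min (G.vB i / G.lamB γ) (G.vA i / G.lamA γ)

theorem supp_le_left (γ : ℝ) (i : Fin n) : G.supp γ i ≤ G.vB i / G.lamB γ := min_le_left _ _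

theorem supp_le_right (γ : ℝ) (i : Fin n) : G.supp γ i ≤ G.vA i / G.lamA γ := min_le_right _ _

theorem supp_eq_or (γ : ℝ) (i : Fin n) :
    G.supp γ i = G.vB i / G.lamB γ ∨ G.supp γ i = G.vA i / G.lamA γ := min_choice _ _

section Solution

variable [NeZero n] {γ : ℝ}

/-- With γ = λ_A / λ_B, the condition γ < v^A_i / v^B_i reads b_i < a_i. This merges the two cases
in the definition of the laws into one formula with the minimum `supp`. -/
theorem mem_Omega_iff (hXA : 0 < XA) (hXB : 0 < XB) (hγ : γ ∈ G.Solutions) (i : Fin n) :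
    i ∈ G.Omega γ ↔ G.vB i / G.lamB γ < G.vA i / G.lamA γ := by
  have hA := G.lamA_pos hXB hγ.1
  have hB := G.lamB_pos hXA hγ.1
  have h : i ∈ G.Omega γ ↔ γ < G.vA i / G.vB i := by simp [Omega]
  rw [h, lt_div_iff₀ (G.vB_pos i), div_lt_div_iff₀ hB hA]
  nth_rw 1 [G.eq_lamA_div_lamB hXA hXB hγ]
  rw [div_mul_eq_mul_div, div_lt_iff₀ hB, mul_comm (G.lamA γ)]

theorem supp_of_mem (hXA : 0 < XA) (hXB : 0 < XB) (hγ : γ ∈ G.Solutions) {i : Fin n}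
    (hi : i ∈ G.Omega γ) : G.supp γ i = G.vB i / G.lamB γ :=
  min_eq_left ((G.mem_Omega_iff hXA hXB hγ i).1 hi).le

theorem supp_of_notMem (hXA : 0 < XA) (hXB : 0 < XB) (hγ : γ ∈ G.Solutions) {i : Fin n}
    (hi : i ∉ G.Omega γ) : G.supp γ i = G.vA i / G.lamA γ :=
  min_eq_right (not_lt.1 fun h => hi ((G.mem_Omega_iff hXA hXB hγ i).2 h))

theorem lawA_eq (hXA : 0 < XA) (hXB : 0 < XB) (hγ : γ ∈ G.Solutions) (i : Fin n) :
    G.lawA γ i = uniformType (G.supp γ i) (G.vB i / G.lamB γ) := by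
  unfold lawA
  split_ifs with h
  · rw [G.supp_of_mem hXA hXB hγ h]
  · rw [G.supp_of_notMem hXA hXB hγ h]

theorem lawB_eq (hXA : 0 < XA) (hXB : 0 < XB) (hγ : γ ∈ G.Solutions) (i : Fin n) :
    G.lawB γ i = uniformType (G.supp γ i) (G.vA i / G.lamA γ) := by
  unfold lawB
  split_ifs with h
  · rw [G.supp_of_mem hXA hXB hγ h]
  · rw [G.supp_of_notMem hXA hXB hγ h]

theorem supp_pos (hXA : 0 < XA) (hXB : 0 < XB) (hγ : γ ∈ G.Solutions) (i : Fin n) :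
    0 < G.supp γ i :=
  lt_min (div_pos (G.vB_pos i) (G.lamB_pos hXA hγ.1)) (div_pos (G.vA_pos i) (G.lamA_pos hXB hγ.1))

/-- In expectation, the uniform-type laws of player A spend exactly the budget. -/
theorem sum_mean_lawA (hXA : 0 < XA) (hXB : 0 < XB) (hγ : γ ∈ G.Solutions) :
    ∑ i, G.supp γ i ^ 2 / (2 * (G.vB i / G.lamB γ)) = XA := by
  have hA := G.lamA_pos hXB hγ.1
  have hB := G.lamB_pos hXA hγ.1
  have hγ0 := hγ.1
  have hγe : G.lamA γ = γ * G.lamB γ := by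
    have := G.eq_lamA_div_lamB hXA hXB hγ
    field_simp at this
    linarith
  have h1 : ∑ i ∈ G.Omega γ, G.supp γ i ^ 2 / (2 * (G.vB i / G.lamB γ)) =
      1 / (2 * G.lamB γ) * ∑ i ∈ G.Omega γ, G.vB i := by
    rw [Finset.mul_sum]
    refine Finset.sum_congr rfl fun i hi => ?_
    have := G.vB_pos i
    rw [G.supp_of_mem hXA hXB hγ hi]
    field_simp
  have h2 : ∑ i ∈ (G.Omega γ)ᶜ, G.supp γ i ^ 2 / (2 * (G.vB i / G.lamB γ)) =
      1 / (2 * γ ^ 2 * G.lamB γ) * ∑ i ∈ (G.Omega γ)ᶜ, G.vA i ^ 2 / G.vB i := by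
    rw [Finset.mul_sum]
    refine Finset.sum_congr rfl fun i hi => ?_
    have := G.vB_pos i
    rw [G.supp_of_notMem hXA hXB hγ (Finset.mem_compl.1 hi), hγe]
    field_simp
  rw [← Finset.sum_add_sum_compl (G.Omega γ), h1, h2]
  -- Up to the factor X_A / λ_B, the left side is the definition of λ_B.
  have h3 : 1 / (2 * G.lamB γ) * ∑ i ∈ G.Omega γ, G.vB i +
      1 / (2 * γ ^ 2 * G.lamB γ) * ∑ i ∈ (G.Omega γ)ᶜ, G.vA i ^ 2 / G.vB i =
      XA * G.lamB γ / G.lamB γ := by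
    nth_rw 3 [lamB]
    field_simp
  rw [h3, mul_div_cancel_right₀ _ hB.ne']

theorem sum_mean_lawB (hXA : 0 < XA) (hXB : 0 < XB) (hγ : γ ∈ G.Solutions) :
    ∑ i, G.supp γ i ^ 2 / (2 * (G.vA i / G.lamA γ)) = XB := by
  have hA := G.lamA_pos hXB hγ.1
  have hB := G.lamB_pos hXA hγ.1
  have hγ0 := hγ.1
  have hγe : G.lamB γ = G.lamA γ / γ := by
    have := G.eq_lamA_div_lamB hXA hXB hγ
    field_simp at this ⊢
    linarith
  have h1 : ∑ i ∈ G.Omega γ, G.supp γ i ^ 2 / (2 * (G.vA i / G.lamA γ)) =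
      γ ^ 2 / (2 * G.lamA γ) * ∑ i ∈ G.Omega γ, G.vB i ^ 2 / G.vA i := by
    rw [Finset.mul_sum]
    refine Finset.sum_congr rfl fun i hi => ?_
    have := G.vA_pos i
    rw [G.supp_of_mem hXA hXB hγ hi, hγe]
    field_simp
  have h2 : ∑ i ∈ (G.Omega γ)ᶜ, G.supp γ i ^ 2 / (2 * (G.vA i / G.lamA γ)) =
      1 / (2 * G.lamA γ) * ∑ i ∈ (G.Omega γ)ᶜ, G.vA i := by
    rw [Finset.mul_sum]
    refine Finset.sum_congr rfl fun i hi => ?_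
    have := G.vA_pos i
    rw [G.supp_of_notMem hXA hXB hγ (Finset.mem_compl.1 hi)]
    field_simp
  rw [← Finset.sum_add_sum_compl (G.Omega γ), h1, h2]
  have h3 : γ ^ 2 / (2 * G.lamA γ) * ∑ i ∈ G.Omega γ, G.vB i ^ 2 / G.vA i +
      1 / (2 * G.lamA γ) * ∑ i ∈ (G.Omega γ)ᶜ, G.vA i =
      XB * G.lamA γ / G.lamA γ := by
    nth_rw 3 [lamA]
    field_simp
  rw [h3, mul_div_cancel_right₀ _ hA.ne']

/-- Comparable battlefield values make all supports of order `1 / n`. -/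
theorem supp_le (hXA : 0 < XA) (hXB : XA ≤ XB) (hγ : γ ∈ G.Solutions) {wlo whi : ℝ}
    (hlo : 0 < wlo) (hG : G.BoundedValues wlo whi) (i : Fin n) :
    G.supp γ i ≤ 4 * (whi / wlo) * XB / n := by
  have hXB' := hXA.trans_le hXB
  have hA := G.lamA_pos hXB' hγ.1
  have hB := G.lamB_pos hXA hγ.1
  have hhi : 0 < whi := hlo.trans_le ((hG i).1.1.trans (hG i).1.2)
  have hratio : ∀ {s t W l : ℝ}, 0 < W → 0 < l → wlo ≤ t → s ≤ whi →
      s / W / l ≤ whi / wlo * (t / W / l) := by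
    intro s t W l hW hl ht hs
    have : s ≤ whi / wlo * t := by
      rw [div_mul_eq_mul_div, le_div_iff₀ hlo]
      nlinarith
    calc s / W / l ≤ whi / wlo * t / W / l := by gcongr
      _ = _ := by ring
  have hR : 0 ≤ whi / wlo := by positivity
  -- Normalizing totals and λ's are common to all battlefields, so both terms of the minimum vary by
  -- at most the factor whi / wlo.
  have hij : ∀ j, G.supp γ i ≤ whi / wlo * G.supp γ j := by
    intro j
    rw [supp, supp, mul_min_of_nonneg _ _ hR]
    exact min_le_min (hratio G.WB_pos hB (hG j).2.1 (hG i).2.2)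
      (hratio G.WA_pos hA (hG j).1.1 (hG i).1.2)
  -- On each battlefield one of the two laws is uniform on [0, c_j], with mean c_j / 2; hence c_j is
  -- at most twice the sum of the two means.
  have hle : ∀ j, G.supp γ j ≤ 2 * (G.supp γ j ^ 2 / (2 * (G.vB j / G.lamB γ))) +
      2 * (G.supp γ j ^ 2 / (2 * (G.vA j / G.lamA γ))) := by
    intro j
    have hp := G.supp_pos hXA hXB' hγ j
    have hb := div_pos (G.vB_pos j) hB
    have ha := div_pos (G.vA_pos j) hA
    have hself : G.supp γ j = 2 * (G.supp γ j ^ 2 / (2 * G.supp γ j)) := by field_simp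
    rcases G.supp_eq_or γ j with h | h <;> rw [← h, ← hself]
    · exact le_add_of_nonneg_right (by positivity)
    · exact le_add_of_nonneg_left (by positivity)
  have hsum : ∑ j, G.supp γ j ≤ 4 * XB := by
    refine (Finset.sum_le_sum fun j _ => hle j).trans ?_
    rw [Finset.sum_add_distrib, ← Finset.mul_sum, ← Finset.mul_sum, G.sum_mean_lawA hXA hXB' hγ,
      G.sum_mean_lawB hXA hXB' hγ]
    linarith
  have hn : (0 : ℝ) < n := Nat.cast_pos.2 (NeZero.pos n)
  rw [le_div_iff₀ hn]
  calc G.supp γ i * n = ∑ _j : Fin n, G.supp γ i := by simp [mul_comm]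
    _ ≤ ∑ j, whi / wlo * G.supp γ j := Finset.sum_le_sum fun j _ => hij j
    _ = whi / wlo * ∑ j, G.supp γ j := by rw [Finset.mul_sum]
    _ ≤ whi / wlo * (4 * XB) := by gcongr
    _ = _ := by ring

theorem isProbabilityMeasure_lawA (hXA : 0 < XA) (hXB : 0 < XB) (hγ : γ ∈ G.Solutions)
    (i : Fin n) : IsProbabilityMeasure (G.lawA γ i) := by
  rw [G.lawA_eq hXA hXB hγ]
  exact uniformType_isProbabilityMeasure (div_pos (G.vB_pos i) (G.lamB_pos hXA hγ.1))
    (G.supp_pos hXA hXB hγ i).le (G.supp_le_left γ i)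

theorem isProbabilityMeasure_lawB (hXA : 0 < XA) (hXB : 0 < XB) (hγ : γ ∈ G.Solutions)
    (i : Fin n) : IsProbabilityMeasure (G.lawB γ i) := by
  rw [G.lawB_eq hXA hXB hγ]
  exact uniformType_isProbabilityMeasure (div_pos (G.vA_pos i) (G.lamA_pos hXB hγ.1))
    (G.supp_pos hXA hXB hγ i).le (G.supp_le_right γ i)

theorem isProbabilityMeasure_IUA (hXA : 0 < XA) (hXB : 0 < XB) (hγ : γ ∈ G.Solutions) :
    IsProbabilityMeasure (G.IUA γ) := by
  have := G.isProbabilityMeasure_lawA hXA hXB hγ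
  exact Measure.isProbabilityMeasure_map (measurable_rescale XA).aemeasurable

theorem isProbabilityMeasure_IUB (hXA : 0 < XA) (hXB : 0 < XB) (hγ : γ ∈ G.Solutions) :
    IsProbabilityMeasure (G.IUB γ) := by
  have := G.isProbabilityMeasure_lawB hXA hXB hγ
  exact Measure.isProbabilityMeasure_map (measurable_rescale XB).aemeasurable

end Solution

end Game

theorem ae_nonneg_map_rescale {n : ℕ} {M : Fin n → Measure ℝ} [∀ i, SigmaFinite (M i)] {X : ℝ}
    (hX : 0 ≤ X) (hM : ∀ i, ∀ᵐ t ∂M i, 0 ≤ t) :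
    ∀ᵐ x ∂(Measure.pi M).map (rescale X), ∀ i, 0 ≤ x i := by
  rw [ae_map_iff (measurable_rescale X).aemeasurable]
  · have h : ∀ᵐ a ∂Measure.pi M, ∀ i, 0 ≤ a i :=
      ae_all_iff.2 fun i => (Measure.quasiMeasurePreserving_eval M i).ae (hM i)
    filter_upwards [h] with a ha i
    unfold rescale
    split_ifs
    · exact le_rfl
    · exact mul_nonneg (div_nonneg (ha i) (Finset.sum_nonneg fun j _ => ha j)) hX
  · have : {x : Fin n → ℝ | ∀ i, 0 ≤ x i} = ⋂ i, {x | 0 ≤ x i} := by ext; simp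
    rw [this]
    exact MeasurableSet.iInter fun i => measurableSet_le measurable_const (measurable_pi_apply i)

namespace Game

variable {n : ℕ} {XA XB : ℝ} (G : Game n XA XB) [NeZero n] {γ : ℝ}

theorem ae_nonneg_IUA (hXA : 0 < XA) (hXB : 0 < XB) (hγ : γ ∈ G.Solutions) :
    ∀ᵐ x ∂G.IUA γ, ∀ i, 0 ≤ x i := by
  have := G.isProbabilityMeasure_lawA hXA hXB hγ
  refine ae_nonneg_map_rescale hXA.le fun i => ?_
  rw [G.lawA_eq hXA hXB hγ]
  filter_upwards [ae_mem_Icc_uniformType (G.supp_pos hXA hXB hγ i).le] with t ht using ht.1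

theorem ae_nonneg_IUB (hXA : 0 < XA) (hXB : 0 < XB) (hγ : γ ∈ G.Solutions) :
    ∀ᵐ x ∂G.IUB γ, ∀ i, 0 ≤ x i := by
  have := G.isProbabilityMeasure_lawB hXA hXB hγ
  refine ae_nonneg_map_rescale hXB.le fun i => ?_
  rw [G.lawB_eq hXA hXB hγ]
  filter_upwards [ae_mem_Icc_uniformType (G.supp_pos hXA hXB hγ i).le] with t ht using ht.1

end Game

/-! ### Closeness of the marginals for large n -/

theorem two_mul_exp_neg_le {ε z : ℝ} (hε : 0 < ε) (hz : 3 * max 1 (Real.log ε⁻¹) ≤ z) :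
    2 * Real.exp (-z) ≤ ε / 2 := by
  have h1 := le_max_left 1 (Real.log ε⁻¹)
  have h2 := le_max_right 1 (Real.log ε⁻¹)
  have hhalf : Real.exp (-1) ≤ 1 / 2 := by
    rw [Real.exp_neg, ← one_div]
    exact one_div_le_one_div_of_le two_pos (by linarith [Real.add_one_le_exp 1])
  have hε' : Real.exp (-Real.log ε⁻¹) = ε := by
    rw [Real.log_inv, neg_neg, Real.exp_log hε]
  -- The constant 3 pays for 1 + 1 + log ε⁻¹: each 1 gives a factor at most 1/2, the logarithm gives
  -- ε.
  calc 2 * Real.exp (-z) ≤ 2 * Real.exp (-1 + -1 + -Real.log ε⁻¹) := by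
        gcongr; linarith
    _ = 2 * (Real.exp (-1) * Real.exp (-1) * ε) := by rw [Real.exp_add, Real.exp_add, hε']
    _ ≤ 2 * (1 / 2 * (1 / 2) * ε) := by gcongr
    _ = ε / 2 := by ring

/-- If all supports are of order `1 / n` and `n` is large, then rescaling a product of
uniform-type laws to its expected sum hardly changes the marginals. -/
theorem monotoneClose_map_rescale_of_large {n : ℕ} [NeZero n] {c b : Fin n → ℝ}
    (hb : ∀ i, 0 < b i) (hc : ∀ i, 0 ≤ c i) (hcb : ∀ i, c i ≤ b i) {X C ε : ℝ} (hX : 0 < X)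
    (hC : 0 < C) (hcC : ∀ i, c i ≤ C / n) (hsum : ∑ i, c i ^ 2 / (2 * b i) = X)
    (hε : 0 < ε) (hε1 : ε ≤ 1)
    (hn : 3 * (2 * C ^ 2 / X ^ 2) * ε⁻¹ ^ 2 * max 1 (Real.log ε⁻¹) ≤ n) (i : Fin n) :
    MonotoneClose
      (((Measure.pi fun i => uniformType (c i) (b i)).map (rescale X)).map fun x => x i)
      (uniformType (c i) (b i)) ε := by
  have hprob : ∀ i, IsProbabilityMeasure (uniformType (c i) (b i)) :=
    fun i => uniformType_isProbabilityMeasure (hb i) (hc i) (hcb i)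
  have hn0 : (0 : ℝ) < n := Nat.cast_pos.2 (NeZero.pos n)
  have hmem : ∀ i, ∀ᵐ t ∂uniformType (c i) (b i), t ∈ Icc 0 (C / n) := fun i => by
    filter_upwards [ae_mem_Icc_uniformType (hc i)] with t ht using ⟨ht.1, ht.2.trans (hcC i)⟩
  have hmean : ∑ i, ∫ t, t ∂uniformType (c i) (b i) = X := by
    rw [← hsum]
    exact Finset.sum_congr rfl fun i _ => integral_id_uniformType (hb i) (hc i) (hcb i)
  have h := measureReal_abs_sum_sub_ge_le hmem hmean (r := ε / 2 * X) (by positivity)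
  have hexp : 3 * max 1 (Real.log ε⁻¹) ≤ 2 * (ε / 2 * X) ^ 2 / (n * (C / n) ^ 2) := by
    have h1 : 2 * (ε / 2 * X) ^ 2 / (n * (C / n) ^ 2) = n / (2 * C ^ 2 / X ^ 2 * ε⁻¹ ^ 2) := by
      field_simp
    rw [h1, le_div_iff₀ (by positivity)]
    linarith
  -- The error ε is split evenly between the scaling factor and the probability of the bad event.
  have := monotoneClose_map_rescale hb hc hcb hX (τ := ε / 2) (by positivity) (by linarith)
    (h.trans (two_mul_exp_neg_le hε hexp)) i
  rwa [add_halves] at this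

/-! ### The approximate equilibrium -/

namespace Game

variable {n : ℕ} {XA XB : ℝ} (G : Game n XA XB) [NeZero n] {γ : ℝ}

theorem ae_mem_Icc_lawA (hXA : 0 < XA) (hXB : 0 < XB) (hγ : γ ∈ G.Solutions) {T : ℝ}
    (hT : ∀ i, G.supp γ i ≤ T) (i : Fin n) : ∀ᵐ t ∂G.lawA γ i, t ∈ Icc 0 T := by
  rw [G.lawA_eq hXA hXB hγ]
  filter_upwards [ae_mem_Icc_uniformType (G.supp_pos hXA hXB hγ i).le] with t ht
  exact ⟨ht.1, ht.2.trans (hT i)⟩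

theorem ae_mem_Icc_lawB (hXA : 0 < XA) (hXB : 0 < XB) (hγ : γ ∈ G.Solutions) {T : ℝ}
    (hT : ∀ i, G.supp γ i ≤ T) (i : Fin n) : ∀ᵐ t ∂G.lawB γ i, t ∈ Icc 0 T := by
  rw [G.lawB_eq hXA hXB hγ]
  filter_upwards [ae_mem_Icc_uniformType (G.supp_pos hXA hXB hγ i).le] with t ht
  exact ⟨ht.1, ht.2.trans (hT i)⟩

section Approximation

variable {ζ : CSFPair} {ε δ : ℝ}

theorem abs_integral_extA_sub_betaA_le (hXA : 0 < XA) (hXB : 0 < XB) (hγ : γ ∈ G.Solutions)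
    (hT : ∀ i, G.supp γ i ≤ 2 * XB) (hε : 0 ≤ ε) (hδ : δ ∈ G.Delta γ ζ ε) (i : Fin n) {y : ℝ}
    (hy : y ∈ Icc 0 (2 * XB)) :
    |∫ x, ζ.extA x y ∂G.lawA γ i - ∫ x, betaA G.α x y ∂G.lawA γ i| ≤ ε + δ := by
  have := G.isProbabilityMeasure_lawA hXA hXB hγ i
  refine abs_integral_sub_le_of_measureReal_le (ζ.unitMonotone_extA.measurable_left y)
    (fun x => ζ.unitMonotone_extA.mem_unit x y) (measurable_betaA_left _ y)
    (fun x => betaA_mem_unit G.α_mem x y) (G.ae_mem_Icc_lawA hXA hXB hγ hT i) hε ?_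
  convert hδ.2.1 i y hy using 2
  ext x
  refine and_congr_right fun hx => ?_
  rw [ζ.extA_of_nonneg hx.1 hy.1]

theorem abs_integral_extB_sub_betaB_left_le (hXA : 0 < XA) (hXB : 0 < XB)
    (hγ : γ ∈ G.Solutions) (hT : ∀ i, G.supp γ i ≤ 2 * XB) (hε : 0 ≤ ε)
    (hδ : δ ∈ G.Delta γ ζ ε) (i : Fin n) {y : ℝ} (hy : y ∈ Icc 0 (2 * XB)) :
    |∫ x, ζ.extB x y ∂G.lawA γ i - ∫ x, betaB G.α x y ∂G.lawA γ i| ≤ ε + δ := by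
  have := G.isProbabilityMeasure_lawA hXA hXB hγ i
  refine abs_integral_sub_le_of_measureReal_le (ζ.unitMonotone_extB.measurable_left y)
    (fun x => ζ.unitMonotone_extB.mem_unit x y) (measurable_betaA_right _ y)
    (fun x => betaB_mem_unit G.α_mem x y) (G.ae_mem_Icc_lawA hXA hXB hγ hT i) hε ?_
  convert hδ.2.1 i y hy using 2
  ext x
  refine and_congr_right fun hx => ?_
  rw [ζ.extB_of_nonneg hx.1 hy.1, ζ.abs_sub_betaA_eq G.α hx.1 hy.1, betaB_eq]

theorem abs_integral_extA_sub_betaA_right_le (hXA : 0 < XA) (hXB : 0 < XB)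
    (hγ : γ ∈ G.Solutions) (hT : ∀ i, G.supp γ i ≤ 2 * XB) (hε : 0 ≤ ε)
    (hδ : δ ∈ G.Delta γ ζ ε) (i : Fin n) {x : ℝ} (hx : x ∈ Icc 0 (2 * XB)) :
    |∫ y, ζ.extA x y ∂G.lawB γ i - ∫ y, betaA G.α x y ∂G.lawB γ i| ≤ ε + δ := by
  have := G.isProbabilityMeasure_lawB hXA hXB hγ i
  refine abs_integral_sub_le_of_measureReal_le (ζ.unitMonotone_extA.measurable_right x)
    (fun y => ζ.unitMonotone_extA.mem_unit x y) (measurable_betaA_right _ x)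
    (fun y => betaA_mem_unit G.α_mem x y) (G.ae_mem_Icc_lawB hXA hXB hγ hT i) hε ?_
  convert hδ.2.2 i x hx using 2
  ext y
  refine and_congr_right fun hy => ?_
  rw [ζ.extA_of_nonneg hx.1 hy.1, ζ.abs_sub_betaA_eq G.α hx.1 hy.1]

end Approximation

/-- Closeness of the marginals to the uniform-type laws makes the independently uniform strategies
an approximate equilibrium. -/
theorem deviationGainLe_of_monotoneClose (hXA : 0 < XA) (hXB : XA ≤ XB) (hγ : γ ∈ G.Solutions)
    {ζ : CSFPair} {ε δ : ℝ} (hT : ∀ i, G.supp γ i ≤ 2 * XB) (hε : 0 ≤ ε)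
    (hδ : δ ∈ G.Delta γ ζ ε)
    (hA : ∀ i, MonotoneClose ((G.IUA γ).map fun x => x i) (G.lawA γ i) ε)
    (hB : ∀ i, MonotoneClose ((G.IUB γ).map fun x => x i) (G.lawB γ i) ε) :
    G.DeviationGainLe ζ (G.IUA γ) (G.IUB γ) (8 * δ + 13 * ε) := by
  have hXB' := hXA.trans_le hXB
  have := G.isProbabilityMeasure_lawA hXA hXB' hγ
  have := G.isProbabilityMeasure_lawB hXA hXB' hγ
  have := G.isProbabilityMeasure_IUA hXA hXB' hγ
  have := G.isProbabilityMeasure_IUB hXA hXB' hγ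
  have hmi : ∀ i, Measurable fun x : Fin n → ℝ => x i := measurable_pi_apply
  have : ∀ i, IsProbabilityMeasure ((G.IUA γ).map fun x => x i) := fun i =>
    Measure.isProbabilityMeasure_map (hmi i).aemeasurable
  have : ∀ i, IsProbabilityMeasure ((G.IUB γ).map fun x => x i) := fun i =>
    Measure.isProbabilityMeasure_map (hmi i).aemeasurable
  have hlA := G.lamA_pos hXB' hγ.1
  have hlB := G.lamB_pos hXA hγ.1
  have hp : ∀ i, 0 < G.vB i / G.lamB γ := fun i => div_pos (G.vB_pos i) hlB
  have hq : ∀ i, 0 < G.vA i / G.lamA γ := fun i => div_pos (G.vA_pos i) hlA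
  have hc : ∀ i, 0 < G.supp γ i := G.supp_pos hXA hXB' hγ
  have hα := G.α_mem
  have hα' : 1 - G.α ∈ Icc (0 : ℝ) 1 := ⟨sub_nonneg.2 hα.2, sub_le_self _ hα.1⟩
  have hnA := G.ae_nonneg_IUA hXA hXB' hγ
  have hnB := G.ae_nonneg_IUB hXA hXB' hγ
  have hδ0 : 0 ≤ δ := hδ.1.1
  constructor
  · intro x hx
    have hd : ∀ᵐ x' ∂Measure.dirac x, ∀ i, 0 ≤ x' i := by rw [ae_dirac_eq]; exact hx.1
    have hxT : ∀ i, x i ∈ Icc 0 (2 * XB) := fun i => ⟨hx.1 i, by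
      have := (Finset.single_le_sum (fun j _ => hx.1 j) (Finset.mem_univ i)).trans hx.2
      linarith⟩
    rw [G.payoffA_eq ζ hd hnB, G.payoffA_eq ζ hnA hnB]
    simp_rw [Measure.map_dirac, integral_dirac]
    have hmain := sum_mul_le_of_indifferent (w := G.wA) (q := fun i => G.vA i / G.lamA γ)
      (k := fun i => (G.vA i / G.lamA γ - G.supp γ i) / (G.vA i / G.lamA γ))
      (m := fun i => G.supp γ i ^ 2 / (2 * (G.vB i / G.lamB γ))) (x := x)
      (u := fun i => ∫ y, ζ.extA (x i) y ∂((G.IUB γ).map fun y => y i))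
      (v := fun i => ∫ y, ∫ x, ζ.extA x y ∂((G.IUA γ).map fun x => x i)
        ∂((G.IUB γ).map fun y => y i))
      -- The deviation pays ε for the opponent's rescaling and ε + δ for replacing ζ; the
      -- equilibrium payoff pays ε for each player's rescaling and again ε + δ.
      (κ := G.lamA γ * G.WA) (e := 2 * ε + δ) (e' := 2 * ε + (ε + δ))
      (fun i => (G.wA_pos i).le) (mul_pos hlA G.WA_pos).le ?_ ?_ ?_ ?_
    · refine hmain.trans (add_le_add_right ?_ _)
      exact mul_le_mul_of_nonneg_right (by linarith) G.WA_pos.le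
    · intro i
      have := G.wA_pos i
      have := G.WA_pos
      simp only [vA]
      field_simp
    · rw [G.sum_mean_lawA hXA hXB' hγ]
      exact hx.2
    · intro i
      have h1 := (abs_le.1 (hB i _ (ζ.unitMonotone_extA.right_apply (x i))
        (ζ.unitMonotone_extA.mem_unit (x i)))).2
      have h2 := (abs_le.1 (G.abs_integral_extA_sub_betaA_right_le hXA hXB' hγ hT hε hδ i
        (hxT i))).2
      have h3 := integral_betaA_uniformType_le hα (hq i) (G.supp_le_right γ i) (hx.1 i)
      rw [← G.lawB_eq hXA hXB' hγ] at h3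
      linarith
    · intro i
      have h1 := ζ.unitMonotone_extA.le_integral_integral (measurable_uncurry_betaA G.α)
        (betaA_mem_unit hα) (hA i) (hB i) (G.ae_mem_Icc_lawB hXA hXB' hγ hT i)
        (fun y hy => G.abs_integral_extA_sub_betaA_le hXA hXB' hγ hT hε hδ i hy)
      have h2 := le_integral_integral_betaA hα (hc i).le (hp i) (hq i) (G.supp_le_left γ i)
        (G.supp_le_right γ i) (G.supp_eq_or γ i)
      -- The payoff integrates A's draw inside, the winning probability has it outside. Fubini is
      -- applied to the Blotto function only, which is jointly measurable.
      rw [← G.lawA_eq hXA hXB' hγ, ← G.lawB_eq hXA hXB' hγ,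
        integral_integral_swap (integrable_of_mem_unit (measurable_uncurry_betaA G.α)
          fun z => betaA_mem_unit hα z.1 z.2)] at h2
      exact h2.trans h1
  · intro y hy
    have hd : ∀ᵐ y' ∂Measure.dirac y, ∀ i, 0 ≤ y' i := by rw [ae_dirac_eq]; exact hy.1
    have hyT : ∀ i, y i ∈ Icc 0 (2 * XB) := fun i => ⟨hy.1 i, by
      have := (Finset.single_le_sum (fun j _ => hy.1 j) (Finset.mem_univ i)).trans hy.2
      linarith⟩
    rw [G.payoffB_eq ζ hnA hd, G.payoffB_eq ζ hnA hnB]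
    simp_rw [Measure.map_dirac, integral_dirac]
    have hmain := sum_mul_le_of_indifferent (w := G.wB) (q := fun i => G.vB i / G.lamB γ)
      (k := fun i => (G.vB i / G.lamB γ - G.supp γ i) / (G.vB i / G.lamB γ))
      (m := fun i => G.supp γ i ^ 2 / (2 * (G.vA i / G.lamA γ))) (x := y)
      (u := fun i => ∫ x, ζ.extB x (y i) ∂((G.IUA γ).map fun x => x i))
      (v := fun i => ∫ y, ∫ x, ζ.extB x y ∂((G.IUA γ).map fun x => x i)
        ∂((G.IUB γ).map fun y => y i))
      (κ := G.lamB γ * G.WB) (e := 2 * ε + δ) (e' := 2 * ε + (ε + δ))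
      (fun i => (G.wB_pos i).le) (mul_pos hlB G.WB_pos).le ?_ ?_ ?_ ?_
    · refine hmain.trans (add_le_add_right ?_ _)
      exact mul_le_mul_of_nonneg_right (by linarith) G.WB_pos.le
    · intro i
      have := G.wB_pos i
      have := G.WB_pos
      simp only [vB]
      field_simp
    · rw [G.sum_mean_lawB hXA hXB' hγ]
      exact hy.2
    · intro i
      have h1 := (abs_le.1 (hA i _ (ζ.unitMonotone_extB.left_apply (y i))
        (fun x => ζ.unitMonotone_extB.mem_unit x (y i)))).2
      have h2 := (abs_le.1 (G.abs_integral_extB_sub_betaB_left_le hXA hXB' hγ hT hε hδ i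
        (hyT i))).2
      have h3 := integral_betaA_uniformType_le hα' (hp i) (G.supp_le_left γ i) (hy.1 i)
      rw [← G.lawA_eq hXA hXB' hγ] at h3
      simp only [betaB_eq] at h2 ⊢
      linarith
    · intro i
      have h1 := ζ.unitMonotone_extB.le_integral_integral (measurable_uncurry_betaB G.α)
        (betaB_mem_unit hα) (hA i) (hB i) (G.ae_mem_Icc_lawB hXA hXB' hγ hT i)
        (fun y hy => G.abs_integral_extB_sub_betaB_left_le hXA hXB' hγ hT hε hδ i hy)
      have h2 := le_integral_integral_betaA hα' (hc i).le (hq i) (hp i) (G.supp_le_right γ i)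
        (G.supp_le_left γ i) (G.supp_eq_or γ i).symm
      rw [← G.lawA_eq hXA hXB' hγ, ← G.lawB_eq hXA hXB' hγ] at h2
      exact h2.trans h1

/-- For large `n`, the independently uniform strategies are an approximate equilibrium. -/
theorem deviationGainLe_of_large (hXA : 0 < XA) (hXB : XA ≤ XB) (hγ : γ ∈ G.Solutions)
    {wlo whi : ℝ} (hlo : 0 < wlo) (hhi : 0 < whi) (hG : G.BoundedValues wlo whi)
    {ζ : CSFPair} {ε δ : ℝ} (hε : 0 < ε) (hε1 : ε ≤ 1)
    (hn : (3 * (2 * (4 * (whi / wlo) * XB) ^ 2 / XA ^ 2) + 2 * (whi / wlo)) * ε⁻¹ ^ 2 *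
      max 1 (Real.log ε⁻¹) ≤ n) (hδ : δ ∈ G.Delta γ ζ ε) :
    G.DeviationGainLe ζ (G.IUA γ) (G.IUB γ) (8 * δ + 13 * ε) := by
  have hXB' := hXA.trans_le hXB
  have hR : 0 < whi / wlo := div_pos hhi hlo
  have hn0 : (0 : ℝ) < n := Nat.cast_pos.2 (NeZero.pos n)
  have hm : 1 ≤ max 1 (Real.log ε⁻¹) := le_max_left _ _
  set m := max 1 (Real.log ε⁻¹) with hmdef
  have hε2 : 1 ≤ ε⁻¹ ^ 2 := one_le_pow₀ ((one_le_inv₀ hε).2 hε1)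
  have hε2m : 1 ≤ ε⁻¹ ^ 2 * m := one_le_mul_of_one_le_of_one_le hε2 hm
  have hC : 0 < 4 * (whi / wlo) * XB := by positivity
  have hnA : 3 * (2 * (4 * (whi / wlo) * XB) ^ 2 / XA ^ 2) * ε⁻¹ ^ 2 * m ≤ n := by
    refine le_trans ?_ hn
    gcongr
    linarith
  have hnB : 3 * (2 * (4 * (whi / wlo) * XB) ^ 2 / XB ^ 2) * ε⁻¹ ^ 2 * m ≤ n := by
    refine le_trans ?_ hnA
    gcongr
  -- This puts the supports inside [0, 2 X_B], where Δ controls the far sets.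
  have hnR : 2 * (whi / wlo) ≤ n := by
    refine le_trans ?_ hn
    rw [mul_assoc]
    refine le_trans ?_ (le_mul_of_one_le_right (by positivity) hε2m)
    exact le_add_of_nonneg_left (by positivity)
  have hsupp := G.supp_le hXA hXB hγ hlo hG
  refine G.deviationGainLe_of_monotoneClose hXA hXB hγ (fun i => (hsupp i).trans ?_) hε.le hδ
    (fun i => ?_) (fun i => ?_)
  · rw [div_le_iff₀ hn0]
    calc 4 * (whi / wlo) * XB = 2 * XB * (2 * (whi / wlo)) := by ring
      _ ≤ _ := by gcongr
  · rw [IUA]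
    simp_rw [G.lawA_eq hXA hXB' hγ]
    exact monotoneClose_map_rescale_of_large
      (fun i => div_pos (G.vB_pos i) (G.lamB_pos hXA hγ.1))
      (fun i => (G.supp_pos hXA hXB' hγ i).le) (G.supp_le_left γ) hXA hC hsupp
      (G.sum_mean_lawA hXA hXB' hγ) hε hε1 hnA i
  · rw [IUB]
    simp_rw [G.lawB_eq hXA hXB' hγ]
    exact monotoneClose_map_rescale_of_large
      (fun i => div_pos (G.vA_pos i) (G.lamA_pos hXB' hγ.1))
      (fun i => (G.supp_pos hXA hXB' hγ i).le) (G.supp_le_right γ) hXB' hC hsupp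
      (G.sum_mean_lawB hXA hXB' hγ) hε hε1 hnB i

end Game

/-! ### Choice of the accuracy and conclusion -/

/-- The accuracy `C n^{-1/2} log n` satisfies the size condition. -/
theorem mul_inv_sq_mul_max_le {n : ℕ} (hn : 3 ≤ n) {L C ε : ℝ} (hC : 1 ≤ C)
    (hLC : L ≤ C ^ 2) (hε : ε = C * (n : ℝ) ^ (-(1 / 2) : ℝ) * Real.log n) :
    L * ε⁻¹ ^ 2 * max 1 (Real.log ε⁻¹) ≤ n := by
  have hn3 : (3 : ℝ) ≤ n := by exact_mod_cast hn
  have hn0 : (0 : ℝ) < n := by linarith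
  have hlog : 1 ≤ Real.log n := by
    rw [Real.le_log_iff_exp_le hn0]
    linarith [Real.exp_one_lt_d9]
  have hrp : 0 < (n : ℝ) ^ (-(1 / 2) : ℝ) := Real.rpow_pos_of_pos hn0 _
  have hsq : ((n : ℝ) ^ (-(1 / 2) : ℝ)) ^ 2 = (n : ℝ)⁻¹ := by
    rw [← Real.rpow_natCast, ← Real.rpow_mul hn0.le]
    norm_num [Real.rpow_neg_one]
  have hε0 : 0 < ε := by rw [hε]; positivity
  have hmax : max 1 (Real.log ε⁻¹) ≤ Real.log n := by
    refine max_le hlog ?_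
    -- Since C log n ≥ 1, this gives log ε⁻¹ ≤ (log n) / 2.
    have h1 : (n : ℝ) ^ (-(1 / 2) : ℝ) ≤ ε := by
      rw [hε]
      nlinarith [mul_le_mul_of_nonneg_left hC hrp.le,
        mul_le_mul_of_nonneg_left hlog (mul_pos (one_pos.trans_le hC) hrp).le]
    have h2 := Real.log_le_log hrp h1
    rw [Real.log_rpow hn0] at h2
    rw [Real.log_inv]
    linarith
  have hε2 : ε⁻¹ ^ 2 = n / (C ^ 2 * Real.log n ^ 2) := by
    rw [hε, inv_pow, mul_pow, mul_pow, hsq]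
    field_simp
  have hC0 : 0 < C := by linarith
  rw [hε2]
  calc L * (n / (C ^ 2 * Real.log n ^ 2)) * max 1 (Real.log ε⁻¹)
      ≤ C ^ 2 * (n / (C ^ 2 * Real.log n ^ 2)) * Real.log n := by gcongr
    _ = n / Real.log n := by field_simp
    _ ≤ n := div_le_self hn0.le hlog

end LotteryBlotto

theorem mainTheorem5 (XA XB wlo whi : ℝ) (hXA : 0 < XA) (hXB : XA ≤ XB)
    (hlo : 0 < wlo) (hhi : 0 < whi) :
    (∃ f : ℕ → ℝ, LotteryBlotto.IsSoftO f (fun n : ℕ => (n : ℝ) ^ (-(1 / 2) : ℝ)) ∧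
      ∀ n : ℕ, 3 ≤ n → ∀ (G : LotteryBlotto.Game n XA XB) (ζ : LotteryBlotto.CSFPair),
        G.BoundedValues wlo whi →
        ∃ ε : ℝ, 0 < ε ∧ ε ≤ f n ∧
          ∀ γ ∈ G.Solutions, ∀ δ ∈ G.Delta γ ζ ε,
            G.DeviationGainLe ζ (G.IUA γ) (G.IUB γ) (8 * δ + 13 * ε)) ∧
    (∃ L : ℝ, 0 < L ∧
      ∀ ε : ℝ, 0 < ε → ε ≤ 1 →
        ∀ n : ℕ, 3 ≤ n → L * ε⁻¹ ^ 2 * max 1 (Real.log ε⁻¹) ≤ (n : ℝ) →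
          ∀ (G : LotteryBlotto.Game n XA XB) (ζ : LotteryBlotto.CSFPair),
            G.BoundedValues wlo whi →
            ∀ γ ∈ G.Solutions, ∀ δ ∈ G.Delta γ ζ ε,
              G.DeviationGainLe ζ (G.IUA γ) (G.IUB γ) (8 * δ + 13 * ε)) := by
  -- The first summand serves the Hoeffding bound, the second keeps the supports below 2 X_B.
  set L : ℝ := 3 * (2 * (4 * (whi / wlo) * XB) ^ 2 / XA ^ 2) + 2 * (whi / wlo) with hL
  have hXB' := hXA.trans_le hXB
  have hL0 : 0 < L := by positivity
  constructor
  · set C : ℝ := max 1 L with hCdef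
    have hC1 : 1 ≤ C := le_max_left _ _
    have hLC : L ≤ C ^ 2 := (le_max_right 1 L).trans (le_self_pow₀ hC1 two_ne_zero)
    refine ⟨fun n => C * (n : ℝ) ^ (-(1 / 2) : ℝ) * Real.log n, ⟨1, ?_⟩, ?_⟩
    · simp_rw [pow_one, mul_assoc]
      exact (Asymptotics.isBigO_refl _ _).const_mul_left C
    · intro n hn G ζ hG
      have : NeZero n := ⟨by lia⟩
      have hn1 : (1 : ℝ) < n := by exact_mod_cast (by lia : 1 < n)
      have hlog := Real.log_pos hn1
      have hε0 : 0 < C * (n : ℝ) ^ (-(1 / 2) : ℝ) * Real.log n := by positivity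
      refine ⟨_, hε0, le_rfl, fun γ hγ δ hδ => ?_⟩
      -- For small n the accuracy may exceed 1; then 13ε ≥ 1 and the claim is trivial, as payoffs
      -- lie between 0 and the total value.
      rcases le_total (C * (n : ℝ) ^ (-(1 / 2) : ℝ) * Real.log n) 1 with h1 | h1
      · exact G.deviationGainLe_of_large hXA hXB hγ hlo hhi hG hε0 h1
          (LotteryBlotto.mul_inv_sq_mul_max_le hn hC1 hLC rfl) hδ
      · have := G.isProbabilityMeasure_IUA hXA hXB' hγ
        have := G.isProbabilityMeasure_IUB hXA hXB' hγ
        exact G.deviationGainLe_of_one_le ζ (G.ae_nonneg_IUA hXA hXB' hγ)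
          (G.ae_nonneg_IUB hXA hXB' hγ) (by linarith [hδ.1.1])
  · refine ⟨L, hL0, fun ε hε hε1 n hn3 hn G ζ hG γ hγ δ hδ => ?_⟩
    have : NeZero n := ⟨by lia⟩
    exact G.deviationGainLe_of_large hXA hXB hγ hlo hhi hG hε hε1 hn hδ
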